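/- Let $(\mathcal N,h,J)$ be a compact Kähler manifold (a compact smooth manifold with a Riemannian metric $h$ and a smooth, $h$-orthogonal endomorphism field $J$ of the tangent bundle with $J^2=-1$ that is parallel for the Levi-Civita connection). For a smooth map $Q:\mathbb R^2\to\mathcal N$ put $$E(Q)=\frac12\int_{\mathbb R^2}|\nabla Q|^2\,dx,\qquad |\nabla Q|^2=\sum_{i=1}^2 h(\partial_{x_i}Q,\partial_{x_i}Q),$$ and call $Q$ harmonic if $\sum_{i=1}^2\nabla_{x_i}\partial_{x_i}Q=0$, where $\nabla$ is the connection on $Q^*T\mathcal N$ induced by the Levi-Civita connection of $h$. Let $$E_*=\inf\{E(Q): Q:\mathbb R^2\to\mathcal N \text{ a harmonic map with } E(Q)>0\}\in[0,\infty],$$ with $E_*=\infty$ if there is no such map of finite energy. Let $C_{1,2}$ be the sharp constant of the Gagliardo–Nirenberg inequality $$\|f\|_{L^4(\mathbb R^2)}\le C_{1,2}\,\|f\|_{L^2(\mathbb R^2)}^{1/2}\,\|\nabla f\|_{L^2(\mathbb R^2)}^{1/2},$$ that is, the least constant for which it holds for all real-valued $f\in C_c^\infty(\mathbb R^2)$.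 Then $E_*>0$. Moreover, for every real upper bound $R_{\mathcal N}$ of the sectional curvatures of $\mathcal N$, $$E_*\ \ge\ \frac12\,\frac1{C_{1,2}^4\,R_{\mathcal N}}\quad\text{if } R_{\mathcal N}>0,\qquad\text{and}\qquad E_*=\infty\quad\text{if } R_{\mathcal N}\le 0.$$ -/

import Mathlib

open scoped Manifold ContDiff NNReal ENNReal
open MeasureTheory

noncomputable section

namespace KahlerHarmonic

/-- The Euclidean plane `ℝ²`, with its Euclidean norm and Lebesgue measure. -/
abbrev Plane : Type := EuclideanSpace ℝ (Fin 2)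

/-- The partial derivative `∂_{x_i} V` of a map from the plane to a vector space. -/
def partialD {F : Type*} [NormedAddCommGroup F] [NormedSpace ℝ F]
    (i : Fin 2) (V : Plane → F) (x : Plane) : F :=
  fderiv ℝ V x (EuclideanSpace.single i 1)

section LocalGeometry

/-! Riemannian geometry of a metric tensor `G` on an open subset of a vector space `E`
(a metric read in a chart). -/

variable {E : Type*} [NormedAddCommGroup E] [NormedSpace ℝ E]

/-- The Christoffel symbol `Γ_y(v, w)` of the Levi-Civita connection of the metric tensor `G`:
the vector determined by
`2 G_y(Γ_y(v, w), z) = (∂_v G)(w, z) + (∂_w G)(v, z) - (∂_z G)(v, w)` for all `z`.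
The nondegenerate form `G y` is inverted as a map from `E` to its dual. -/
def christoffel (G : E → E →L[ℝ] E →L[ℝ] ℝ) (y v w : E) : E :=
  (G y).inverse ((1 / 2 : ℝ) •
    (fderiv ℝ G y v w + fderiv ℝ G y w v - ((fderiv ℝ G y).flip v).flip w))

/-- The Riemann curvature tensor
`R(v, w) z = ∇_v ∇_w z - ∇_w ∇_v z` (constant coordinate fields `v`, `w`, `z`) at `y`. -/
def curvature (G : E → E →L[ℝ] E →L[ℝ] ℝ) (y v w z : E) : E :=
  fderiv ℝ (fun y' => christoffel G y' w z) y v - fderiv ℝ (fun y' => christoffel G y' v z) y w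
    + christoffel G y v (christoffel G y w z) - christoffel G y w (christoffel G y v z)

/-- The sectional curvature of the plane spanned by `v` and `w` at `y`. -/
def sectional (G : E → E →L[ℝ] E →L[ℝ] ℝ) (y v w : E) : ℝ :=
  G y (curvature G y v w w) v / (G y v v * G y w w - G y v w ^ 2)

/-- The covariant derivative `∇_{x_i} V` along the map `u` of the vector field `V` along `u`,
for the Levi-Civita connection of `G`. -/
def covAlong (G : E → E →L[ℝ] E →L[ℝ] ℝ) (u : Plane → E) (i : Fin 2) (V : Plane → E)
    (x : Plane) : E :=
  partialD i V x + christoffel G (u x) (partialD i u x) (V x)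

/-- The tension field `∑ᵢ ∇_{x_i} ∂_{x_i} u`. -/
def tension (G : E → E →L[ℝ] E →L[ℝ] ℝ) (u : Plane → E) (x : Plane) : E :=
  ∑ i : Fin 2, covAlong G u i (partialD i u) x

end LocalGeometry

section Manifold

variable {E : Type*} [NormedAddCommGroup E] [NormedSpace ℝ E]
  {N : Type*} [TopologicalSpace N] [ChartedSpace E N] [IsManifold 𝓘(ℝ, E) ∞ N]

variable (E N) in
/-- Smooth Riemannian metrics on `N`. -/
abbrev Metric : Type _ :=
  Bundle.ContMDiffRiemannianMetric 𝓘(ℝ, E) ∞ E (fun p : N => TangentSpace 𝓘(ℝ, E) p)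

/-- The metric `h` read in the chart `e`. -/
def metricInChart (h : Metric E N) (e : OpenPartialHomeomorph N E) (y : E) :
    E →L[ℝ] E →L[ℝ] ℝ :=
  let A : E →L[ℝ] E := mfderiv 𝓘(ℝ, E) 𝓘(ℝ, E) e.symm y
  let B : E →L[ℝ] E →L[ℝ] ℝ := h.inner (e.symm y)
  B.bilinearComp A A

/-- A field `J` of endomorphisms of the tangent spaces, read in the chart `e`. -/
def endoInChart
    (J : ∀ p : N, TangentSpace 𝓘(ℝ, E) p →L[ℝ] TangentSpace 𝓘(ℝ, E) p)
    (e : OpenPartialHomeomorph N E) (y : E) : E →L[ℝ] E :=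
  (mfderiv 𝓘(ℝ, E) 𝓘(ℝ, E) e (e.symm y)) ∘L
    ((J (e.symm y)) ∘L (mfderiv 𝓘(ℝ, E) 𝓘(ℝ, E) e.symm y))

/-- `(N, h, J)` is a Kähler manifold: `J` is a smooth almost complex structure, orthogonal for
`h`, and parallel for the Levi-Civita connection of `h`. -/
structure IsKahler (h : Metric E N)
    (J : ∀ p : N, TangentSpace 𝓘(ℝ, E) p →L[ℝ] TangentSpace 𝓘(ℝ, E) p) : Prop where
  smooth : ContMDiff 𝓘(ℝ, E) (𝓘(ℝ, E).prod 𝓘(ℝ, E →L[ℝ] E)) ∞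
    (fun p : N => Bundle.TotalSpace.mk' (E →L[ℝ] E)
      (E := fun p : N => TangentSpace 𝓘(ℝ, E) p →L[ℝ] TangentSpace 𝓘(ℝ, E) p) p (J p))
  sq_eq_neg : ∀ (p : N) (v : TangentSpace 𝓘(ℝ, E) p), J p (J p v) = -v
  orthogonal : ∀ (p : N) (v w : TangentSpace 𝓘(ℝ, E) p),
    h.inner p (J p v) (J p w) = h.inner p v w
  parallel : ∀ e ∈ atlas E N, ∀ y ∈ e.target, ∀ v w : E,
    fderiv ℝ (endoInChart J e) y v w
      + christoffel (metricInChart h e) y v (endoInChart J e y w)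
      - endoInChart J e y (christoffel (metricInChart h e) y v w) = 0

/-- The set of all sectional curvatures of `(N, h)`, at all points and for all tangent planes. -/
def sectionalCurvatures (h : Metric E N) : Set ℝ :=
  {k | ∃ e ∈ atlas E N, ∃ y ∈ e.target, ∃ v w : E, LinearIndependent ℝ ![v, w] ∧
    k = sectional (metricInChart h e) y v w}

/-- A harmonic map `Q : ℝ² → (N, h)`: a smooth map with vanishing tension field
`∑ᵢ ∇_{x_i} ∂_{x_i} Q = 0` (an equation read in the charts of the target). -/
def IsHarmonicMap (h : Metric E N) (Q : Plane → N) : Prop :=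
  ContMDiff 𝓘(ℝ, Plane) 𝓘(ℝ, E) ∞ Q ∧
    ∀ e ∈ atlas E N, ∀ x : Plane, Q x ∈ e.source →
      tension (metricInChart h e) (fun x' => e (Q x')) x = 0

/-- The squared length `|∇Q|² = ∑ᵢ h(∂_{x_i} Q, ∂_{x_i} Q)`. -/
def gradSq (h : Metric E N) (Q : Plane → N) (x : Plane) : ℝ :=
  ∑ i : Fin 2, h.inner (Q x)
    (mfderiv 𝓘(ℝ, Plane) 𝓘(ℝ, E) Q x (EuclideanSpace.single i 1 : Plane))
    (mfderiv 𝓘(ℝ, Plane) 𝓘(ℝ, E) Q x (EuclideanSpace.single i 1 : Plane))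

/-- The energy `E(Q) = ½ ∫ |∇Q|² dx`, in `[0, ∞]`. -/
def energy (h : Metric E N) (Q : Plane → N) : ℝ≥0∞ :=
  (1 / 2) * ∫⁻ x : Plane, ENNReal.ofReal (gradSq h Q x)

/-- The critical energy: the infimum of the energies of the harmonic maps `ℝ² → N` of positive
energy. It is `∞` if there is no such map of finite energy. -/
def criticalEnergy (h : Metric E N) : ℝ≥0∞ :=
  sInf {a | ∃ Q : Plane → N, IsHarmonicMap h Q ∧ 0 < energy h Q ∧ a = energy h Q}

end Manifold

/-- The sharp constant in the Gagliardo-Nirenberg inequality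
`‖f‖₄ ≤ C ‖f‖₂^{1/2} ‖∇f‖₂^{1/2}` on `ℝ²`: the least `C` that is valid for all
real-valued test functions (equivalently, by density, for all of `H¹(ℝ²)`). -/
def gagliardoNirenberg : ℝ≥0 :=
  sInf {C : ℝ≥0 | ∀ f : Plane → ℝ, ContDiff ℝ ∞ f → HasCompactSupport f →
    eLpNorm f 4 volume ≤
      C * eLpNorm f 2 volume ^ (1 / 2 : ℝ) * eLpNorm (fderiv ℝ f) 2 volume ^ (1 / 2 : ℝ)}

end KahlerHarmonic

end

/-! Write `w = |∇Q|²`, `I = ∫ w = 2E(Q)`, and let `C` be the sharp Gagliardo–Nirenberg constant. For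
harmonic `Q` the Bochner formula reads `½ Δw = |∇dQ|² - (curvature)`. An upper bound `R ≥ 0` for the
curvature makes the last term at most `2R |∂₁Q|² |∂₂Q|² ≤ (R/2) w²`, and Cauchy–Schwarz gives `|∇w|²
≤ 4 w |∇dQ|²`. Hence, formally, `|∇√w|² ≤ ½ Δw + (R/2) w²`.

If integration over the plane were allowed, Gagliardo–Nirenberg for `√w` would give `∫ w² ≤ C⁴ I
(R/2) ∫ w²`, so `C⁴ R I < 2` would force `w = 0`. Integrability of `w²` is not known in advance, so
cutoffs are needed, and they compare `∫ w²` on a ball with `∫ w²` on a larger one. Under the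
stronger assumption `C⁴ R I < 1` the factor in front of the larger ball is below `1/2`; this spare
factor 2 lets a weighted supremum over radii absorb that term, and letting the outer radius grow
gives `w = 0`. Thus a harmonic map of positive energy has `I ≥ 1 / (C⁴ R)`.

The analytic half is `eq_zero_of_bochner`, the geometric half `bochner`; they meet in
`IsHarmonicMap.le_energy`. Compactness supplies some curvature bound `R > 0`, hence positivity of
the critical energy. The case `R ≤ 0` follows from positive bounds tending to `0`. -/

noncomputable section

set_option maxSynthPendingDepth 3

namespace KahlerHarmonic

/-! ### The Gagliardo–Nirenberg inequality with its sharp constant -/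

section GagliardoNirenberg

lemma eLpNorm_two_sq {F : Type*} [NormedAddCommGroup F] (f : Plane → F) :
    eLpNorm f 2 volume ^ 2 = ∫⁻ x, ‖f x‖ₑ ^ 2 := by
  have := eLpNorm_nnreal_pow_eq_lintegral (f := f) (μ := volume) (p := 2) (by norm_num)
  simpa only [ENNReal.coe_ofNat, NNReal.coe_ofNat, ENNReal.rpow_ofNat] using this

lemma eLpNorm_four_pow {F : Type*} [NormedAddCommGroup F] (f : Plane → F) :
    eLpNorm f 4 volume ^ 4 = ∫⁻ x, ‖f x‖ₑ ^ 4 := by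
  have := eLpNorm_nnreal_pow_eq_lintegral (f := f) (μ := volume) (p := 4) (by norm_num)
  simpa only [ENNReal.coe_ofNat, NNReal.coe_ofNat, ENNReal.rpow_ofNat] using this

lemma gagliardoNirenberg_ineq_iff (C : ℝ≥0) (f : Plane → ℝ) :
    eLpNorm f 4 volume ≤
      C * eLpNorm f 2 volume ^ (1 / 2 : ℝ) * eLpNorm (fderiv ℝ f) 2 volume ^ (1 / 2 : ℝ) ↔
    ∫⁻ x, ‖f x‖ₑ ^ 4 ≤
      (C : ℝ≥0∞) ^ 4 * ((∫⁻ x, ‖f x‖ₑ ^ 2) * ∫⁻ x, ‖fderiv ℝ f x‖ₑ ^ 2) := by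
  rw [← ENNReal.pow_le_pow_left_iff (n := 4) (by norm_num), eLpNorm_four_pow, mul_pow, mul_pow,
    ← eLpNorm_two_sq, ← eLpNorm_two_sq, mul_assoc]
  simp only [← ENNReal.rpow_natCast, ← ENNReal.rpow_mul]
  norm_num

/-- The `L¹` Sobolev inequality on the plane, applied to `f²`, bounds `∫ f⁴` by a multiple of `(∫
|f| |∇f|)²`, and Cauchy–Schwarz separates the factors. Existence matters because `sInf ∅ = 0` in
`ℝ≥0`: for an empty set of constants `gagliardoNirenberg` would carry no inequality. -/
lemma exists_gagliardoNirenberg :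
    ∃ C : ℝ≥0, ∀ f : Plane → ℝ, ContDiff ℝ ∞ f → HasCompactSupport f →
      eLpNorm f 4 volume ≤
        C * eLpNorm f 2 volume ^ (1 / 2 : ℝ) * eLpNorm (fderiv ℝ f) 2 volume ^ (1 / 2 : ℝ) := by
  set K := lintegralPowLePowLIntegralFDerivConst (volume : Measure Plane) 2
  -- The argument requires `C ^ 4 ≥ 4 * K`; the summand `1` puts the base above `1`, where it is
  -- dominated by its powers.
  refine ⟨4 * K + 1, fun f hf hc => ?_⟩
  rw [gagliardoNirenberg_ineq_iff]
  have hf1 : ContDiff ℝ 1 f := hf.of_le (by simp)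
  have hd : Differentiable ℝ f := hf1.differentiable one_ne_zero
  have hp : Real.HolderConjugate (Module.finrank ℝ Plane) 2 := by
    rw [finrank_euclideanSpace_fin]
    exact_mod_cast Real.HolderConjugate.two_two
  have hs := lintegral_pow_le_pow_lintegral_fderiv (volume : Measure Plane)
    (u := fun x => f x * f x) (hf1.mul hf1) (hc.mul_left) hp
  have hd2 : ∀ x, ‖fderiv ℝ (fun x => f x * f x) x‖ₑ = 2 * (‖f x‖ₑ * ‖fderiv ℝ f x‖ₑ) := by
    intro x
    rw [fderiv_fun_mul (hd x) (hd x), ← two_smul ℝ, smul_smul, enorm_smul, enorm_mul, mul_assoc]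
    congr 1
    simp [enorm_eq_nnnorm]
  have hH : ∫⁻ x, ‖f x‖ₑ * ‖fderiv ℝ f x‖ₑ ≤
      (∫⁻ x, ‖f x‖ₑ ^ (2 : ℝ)) ^ (1 / 2 : ℝ) * (∫⁻ x, ‖fderiv ℝ f x‖ₑ ^ (2 : ℝ)) ^ (1 / 2 : ℝ) :=
    ENNReal.lintegral_mul_le_Lp_mul_Lq _ Real.HolderConjugate.two_two
      hf.continuous.enorm.aemeasurable
      (hf1.continuous_fderiv one_ne_zero).enorm.aemeasurable
  have hH2 : (∫⁻ x, ‖f x‖ₑ * ‖fderiv ℝ f x‖ₑ) ^ 2 ≤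
      (∫⁻ x, ‖f x‖ₑ ^ 2) * ∫⁻ x, ‖fderiv ℝ f x‖ₑ ^ 2 := by
    refine (pow_le_pow_left' hH 2).trans (le_of_eq ?_)
    rw [mul_pow]
    simp only [← ENNReal.rpow_natCast, ← ENNReal.rpow_mul]
    norm_num
  simp only [hd2] at hs
  rw [lintegral_const_mul' _ _ (by simp)] at hs
  have e1 : ∀ x, ‖f x * f x‖ₑ ^ (2 : ℝ) = ‖f x‖ₑ ^ 4 := by
    intro x
    rw [enorm_mul, ← sq]
    simp only [← ENNReal.rpow_natCast, ← ENNReal.rpow_mul]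
    norm_num
  simp only [e1] at hs
  have e2 : ∀ a : ℝ≥0∞, (2 * a) ^ (2 : ℝ) = 4 * a ^ 2 := by
    intro a
    rw [ENNReal.rpow_two, mul_pow]
    norm_num
  rw [e2] at hs
  refine hs.trans ?_
  rw [← mul_assoc]
  refine mul_le_mul' ?_ hH2
  have hK : K * 4 ≤ (4 * K + 1) ^ 4 := by
    calc K * 4 ≤ 4 * K + 1 := by rw [mul_comm]; exact le_self_add
      _ ≤ _ := le_self_pow₀ le_add_self (by norm_num)
  exact_mod_cast hK

/-- The infimum is itself admissible: for a fixed `f` the condition on `C` is closed. Finiteness of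
both integrals is what makes the right side continuous in `C`. -/
lemma lintegral_pow_four_le {f : Plane → ℝ} (hf : ContDiff ℝ ∞ f) (hc : HasCompactSupport f) :
    ∫⁻ x, ‖f x‖ₑ ^ 4 ≤
      (gagliardoNirenberg : ℝ≥0∞) ^ 4 *
        ((∫⁻ x, ‖f x‖ₑ ^ 2) * ∫⁻ x, ‖fderiv ℝ f x‖ₑ ^ 2) := by
  have hf1 : ContDiff ℝ 1 f := hf.of_le (by simp)
  have h1 : (∫⁻ x, ‖f x‖ₑ ^ 2) ≠ ⊤ := by
    rw [← eLpNorm_two_sq]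
    exact (ENNReal.pow_lt_top (hf.continuous.memLp_of_hasCompactSupport hc).2).ne
  have h2 : (∫⁻ x, ‖fderiv ℝ f x‖ₑ ^ 2) ≠ ⊤ := by
    rw [← eLpNorm_two_sq]
    exact (ENNReal.pow_lt_top ((hf1.continuous_fderiv one_ne_zero).memLp_of_hasCompactSupport
      (hc.fderiv ℝ)).2).ne
  have hcl : IsClosed {C : ℝ≥0 | ∫⁻ x, ‖f x‖ₑ ^ 4 ≤
      (C : ℝ≥0∞) ^ 4 * ((∫⁻ x, ‖f x‖ₑ ^ 2) * ∫⁻ x, ‖fderiv ℝ f x‖ₑ ^ 2)} := by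
    refine isClosed_le continuous_const ?_
    refine (ENNReal.continuous_mul_const (ENNReal.mul_ne_top h1 h2)).comp ?_
    exact (ENNReal.continuous_pow 4).comp ENNReal.continuous_coe
  refine hcl.closure_subset_iff.2 ?_
    (csInf_mem_closure exists_gagliardoNirenberg (OrderBot.bddBelow _))
  intro C hC
  exact (gagliardoNirenberg_ineq_iff C f).1 (hC f hf hc)

lemma norm_sq_eq_sum_partial (L : Plane →L[ℝ] ℝ) :
    ‖L‖ ^ 2 = ∑ i : Fin 2, L (EuclideanSpace.single i 1) ^ 2 := by
  obtain ⟨v, rfl⟩ := (InnerProductSpace.toDual ℝ Plane).surjective L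
  rw [LinearIsometryEquiv.norm_map, EuclideanSpace.norm_sq_eq]
  simp [EuclideanSpace.inner_single_right]

lemma integral_pow_four_le {f : Plane → ℝ} (hf : ContDiff ℝ ∞ f) (hc : HasCompactSupport f) :
    ∫ x, f x ^ 4 ≤ (gagliardoNirenberg : ℝ) ^ 4 *
      ((∫ x, f x ^ 2) * ∫ x, ∑ i : Fin 2, partialD i f x ^ 2) := by
  have hf1 : ContDiff ℝ 1 f := hf.of_le (by simp)
  have hc' : Continuous (fderiv ℝ f) := hf1.continuous_fderiv one_ne_zero
  have key := lintegral_pow_four_le hf hc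
  have conv : ∀ {F : Type} [NormedAddCommGroup F] (g : Plane → F) (n : ℕ), n ≠ 0 →
      Continuous g → HasCompactSupport g →
      ∫⁻ x, ‖g x‖ₑ ^ n = ENNReal.ofReal (∫ x, ‖g x‖ ^ n) := by
    intro F _ g n hn hg hgc
    rw [ofReal_integral_eq_lintegral_ofReal]
    · simp only [ENNReal.ofReal_pow (norm_nonneg _), ofReal_norm]
    · refine (hg.norm.pow n).integrable_of_hasCompactSupport ?_
      exact hgc.comp_left (g := fun y => ‖y‖ ^ n) (by simp [hn])
    · exact Filter.Eventually.of_forall fun x => by positivity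
  rw [conv f 4 (by norm_num) hf.continuous hc, conv f 2 (by norm_num) hf.continuous hc,
    conv (fderiv ℝ f) 2 (by norm_num) hc' (hc.fderiv ℝ),
    ← ENNReal.ofReal_coe_nnreal, ← ENNReal.ofReal_pow (by positivity),
    ← ENNReal.ofReal_mul (by positivity), ← ENNReal.ofReal_mul (by positivity),
    ENNReal.ofReal_le_ofReal_iff (by positivity)] at key
  simpa only [norm_sq_eq_sum_partial, Real.norm_eq_abs, sq_abs,
    (by decide : Even 4).pow_abs, partialD] using key

end GagliardoNirenberg

/-! ### Cutoff functions with controlled gradient -/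

section Cutoff

lemma exists_lipschitz_smoothTransition :
    ∃ K : ℝ≥0, LipschitzWith K Real.smoothTransition := by
  have hc : ContDiff ℝ 1 Real.smoothTransition := Real.smoothTransition.contDiff (n := 1)
  obtain ⟨M, hM⟩ := isCompact_Icc.exists_bound_of_continuousOn (s := Set.Icc (0 : ℝ) 1)
    (hc.continuous_deriv le_rfl).continuousOn
  refine ⟨M.toNNReal, lipschitzWith_of_nnnorm_deriv_le (hc.differentiable one_ne_zero) fun x => ?_⟩
  rw [← NNReal.coe_le_coe, coe_nnnorm]
  refine le_trans ?_ (Real.le_coe_toNNReal M)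
  by_cases hx : x ∈ Set.Icc (0 : ℝ) 1
  · exact hM x hx
  have hM0 : 0 ≤ M := (norm_nonneg _).trans (hM 0 (by simp))
  rw [Set.mem_Icc, not_and_or, not_le, not_le] at hx
  have : deriv Real.smoothTransition x = 0 := by
    rcases hx with hx | hx
    · have : Real.smoothTransition =ᶠ[nhds x] fun _ => 0 := by
        filter_upwards [gt_mem_nhds hx] with y hy using
          Real.smoothTransition.zero_of_nonpos hy.le
      rw [this.deriv_eq, deriv_const]
    · have : Real.smoothTransition =ᶠ[nhds x] fun _ => 1 := by
        filter_upwards [lt_mem_nhds hx] with y hy using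
          Real.smoothTransition.one_of_one_le hy.le
      rw [this.deriv_eq, deriv_const]
  simpa [this] using hM0

/-- A fixed smooth profile is composed with the affine rescaling of `‖x‖`. Its Lipschitz constant
`K` serves all pairs of radii, which the iteration over radii relies on. -/
lemma exists_cutoff :
    ∃ K : ℝ, 0 ≤ K ∧ ∀ ρ σ : ℝ, 0 < ρ → ρ < σ → ∃ η : Plane → ℝ, ContDiff ℝ ∞ η ∧
      HasCompactSupport η ∧ (∀ x, 0 ≤ η x) ∧ (∀ x, η x ≤ 1) ∧
      (∀ x ∈ Metric.closedBall (0 : Plane) ρ, η x = 1) ∧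
      (∀ x ∉ Metric.closedBall (0 : Plane) σ, η x = 0) ∧
      ∀ x, ∑ i : Fin 2, partialD i η x ^ 2 ≤ (K / (σ - ρ)) ^ 2 := by
  obtain ⟨K, hK⟩ := exists_lipschitz_smoothTransition
  refine ⟨K, K.2, fun ρ σ hρ hσ => ?_⟩
  have hd : 0 < σ - ρ := sub_pos.2 hσ
  set η : Plane → ℝ := fun x => Real.smoothTransition ((σ - ‖x‖) / (σ - ρ)) with hη
  have hη1 : ∀ x : Plane, ‖x‖ ≤ ρ → η x = 1 := fun x hx =>
    Real.smoothTransition.one_of_one_le ((one_le_div hd).2 (by linarith))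
  have hη0 : ∀ x : Plane, σ ≤ ‖x‖ → η x = 0 := fun x hx =>
    Real.smoothTransition.zero_of_nonpos (div_nonpos_of_nonpos_of_nonneg (by linarith) hd.le)
  have hη0' : ∀ x ∉ Metric.closedBall (0 : Plane) σ, η x = 0 := fun x hx =>
    hη0 x (by simpa using (not_le.1 (by simpa using hx)).le)
  refine ⟨η, ?_, HasCompactSupport.intro (isCompact_closedBall 0 σ) hη0',
    fun x => Real.smoothTransition.nonneg _, fun x => Real.smoothTransition.le_one _,
    fun x hx => hη1 x (by simpa using hx), hη0', fun x => ?_⟩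
  · rw [contDiff_iff_contDiffAt]
    intro x
    -- The norm is not smooth at the origin, but `η` is constant there.
    by_cases hx : x = 0
    · have : η =ᶠ[nhds x] fun _ => 1 := by
        filter_upwards [Metric.ball_mem_nhds x hρ] with y hy
        subst hx
        exact hη1 y (by simpa using (Metric.mem_ball.1 hy).le)
      exact contDiffAt_const.congr_of_eventuallyEq this
    · exact (Real.smoothTransition.contDiff (n := ⊤)).contDiffAt.comp x
        ((contDiffAt_const.sub (contDiffAt_norm ℝ hx)).div_const _)
  · have hL : LipschitzWith (K * (Real.toNNReal (1 / (σ - ρ)))) η := by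
      refine hK.comp (LipschitzWith.of_dist_le_mul fun a b => ?_)
      rw [Real.coe_toNNReal _ (by positivity), Real.dist_eq, ← sub_div, abs_div, abs_of_pos hd,
        div_eq_inv_mul, one_div]
      refine mul_le_mul_of_nonneg_left ?_ (by positivity)
      rw [sub_sub_sub_cancel_left, dist_comm, dist_eq_norm]
      exact abs_norm_sub_norm_le _ _
    have := norm_fderiv_le_of_lipschitz ℝ hL (x₀ := x)
    rw [NNReal.coe_mul, Real.coe_toNNReal _ (by positivity), mul_one_div] at this
    calc _ = ‖fderiv ℝ η x‖ ^ 2 := (norm_sq_eq_sum_partial _).symm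
      _ ≤ _ := by gcongr

end Cutoff

/-! ### From the Bochner inequality to vanishing below the threshold -/

section Laplacian

lemma ContDiff.partialD {F : Type*} [NormedAddCommGroup F] [NormedSpace ℝ F] {f : Plane → F}
    (hf : ContDiff ℝ ∞ f) (i : Fin 2) : ContDiff ℝ ∞ (partialD i f) :=
  (hf.fderiv_right (m := ∞) (by simp)).clm_apply contDiff_const

/-- The integral of the divergence `½ ∂_i (η² ∂_i w)` of a compactly supported field vanishes. -/
lemma integral_sq_mul_partialD_eq_zero {η w : Plane → ℝ} (hη : ContDiff ℝ ∞ η)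
    (hηc : HasCompactSupport η) (hw : ContDiff ℝ ∞ w) (i : Fin 2) :
    ∫ x, (η x * partialD i η x * partialD i w x
      + 1 / 2 * (η x ^ 2 * partialD i (partialD i w) x)) = 0 := by
  have hwi := ContDiff.partialD hw i
  have hwii := ContDiff.partialD hwi i
  have hηi := ContDiff.partialD hη i
  have hd : Differentiable ℝ η := hη.differentiable (by simp)
  have hfd : ∀ x, fderiv ℝ (fun x => η x ^ 2) x (EuclideanSpace.single i 1)
      = 2 * (η x * partialD i η x) := by
    intro x
    rw [fderiv_fun_pow 2 (hd x)]
    simp [KahlerHarmonic.partialD, mul_assoc]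
  have h1 : Integrable fun x => η x * partialD i η x * partialD i w x :=
    ((hη.continuous.mul hηi.continuous).mul hwi.continuous).integrable_of_hasCompactSupport
      (hηc.mul_right.mul_right)
  have hηc2 : HasCompactSupport fun x => η x ^ 2 :=
    hηc.comp_left (g := fun y : ℝ => y ^ 2) (by simp)
  have h2 : Integrable fun x => η x ^ 2 * partialD i (partialD i w) x :=
    ((hη.continuous.pow 2).mul hwii.continuous).integrable_of_hasCompactSupport hηc2.mul_right
  have h3 : Integrable fun x => η x ^ 2 * partialD i w x :=
    ((hη.continuous.pow 2).mul hwi.continuous).integrable_of_hasCompactSupport hηc2.mul_right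
  have hibp := integral_mul_fderiv_eq_neg_fderiv_mul_of_integrable
    (μ := (volume : Measure Plane)) (f := fun x => η x ^ 2) (g := KahlerHarmonic.partialD i w)
    (v := EuclideanSpace.single i 1)
    (by simp only [hfd]; simpa [mul_assoc] using h1.const_mul 2) h2 h3
    (fun x _ => (hd x).pow 2) (fun x _ => hwi.differentiable (by simp) x)
  rw [integral_add h1 (h2.const_mul _), integral_const_mul]
  change ∫ x, η x ^ 2 * partialD i (partialD i w) x = _ at hibp
  rw [hibp]
  simp only [hfd, mul_assoc]
  rw [integral_const_mul]
  ring

/-- The Laplacian of a function on the plane. -/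
def laplace (w : Plane → ℝ) (x : Plane) : ℝ := ∑ i : Fin 2, partialD i (partialD i w) x

/-- The shift by `ε` keeps the square root smooth at zeros of `w`. Expanding gives `|∇(η√(w+ε))|² =
|∇η|²(w+ε) + η ∇η·∇w + η²|∇w|²/(4(w+ε))`. The Bochner inequality bounds the last term, and the
resulting `½ η² Δw` joins the mixed term to form `½ div(η²∇w)`, which integrates to zero. -/
lemma integral_grad_cutoff_mul_sqrt_le {η w : Plane → ℝ} {R ε : ℝ} (hη : ContDiff ℝ ∞ η)
    (hηc : HasCompactSupport η) (hw : ContDiff ℝ ∞ w) (hw0 : ∀ x, 0 ≤ w x) (hε : 0 < ε)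
    (hgrad : ∀ x, ∑ i : Fin 2, partialD i w x ^ 2
      ≤ 4 * w x * (1 / 2 * laplace w x + R / 2 * w x ^ 2))
    (hnn : ∀ x, 0 ≤ 1 / 2 * laplace w x + R / 2 * w x ^ 2) :
    ∫ x, ∑ i : Fin 2, partialD i (fun y => η y * √(w y + ε)) x ^ 2 ≤
      ∫ x, ((∑ i : Fin 2, partialD i η x ^ 2) * (w x + ε) + R / 2 * (η x ^ 2 * w x ^ 2)) := by
  have hpos : ∀ x, 0 < w x + ε := fun x => add_pos_of_nonneg_of_pos (hw0 x) hε
  have hs : ContDiff ℝ ∞ fun y => √(w y + ε) :=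
    (hw.add contDiff_const).sqrt fun x => (hpos x).ne'
  have hg : ContDiff ℝ ∞ fun y => η y * √(w y + ε) := hη.mul hs
  have hgc : HasCompactSupport fun y => η y * √(w y + ε) := hηc.mul_right
  have hηc2 : HasCompactSupport fun x => η x ^ 2 :=
    hηc.comp_left (g := fun y : ℝ => y ^ 2) (by simp)
  have hpc : ∀ {f : Plane → ℝ}, HasCompactSupport f → ∀ i : Fin 2,
      HasCompactSupport (KahlerHarmonic.partialD i f) := fun hf i =>
    (hf.fderiv ℝ).comp_left (g := fun L : Plane →L[ℝ] ℝ => L (EuclideanSpace.single i 1)) (by simp)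
  have hint : ∀ {f : Plane → ℝ}, Continuous f → HasCompactSupport f → Integrable f :=
    fun hf hc => hf.integrable_of_hasCompactSupport hc
  have hc2 : ∀ {f : Plane → ℝ}, HasCompactSupport f → HasCompactSupport fun x => f x ^ 2 :=
    fun hf => hf.comp_left (g := fun y : ℝ => y ^ 2) (by simp)
  have iA : ∀ i : Fin 2, Integrable fun x =>
      partialD i (fun y => η y * √(w y + ε)) x ^ 2 := fun i =>
    hint ((ContDiff.partialD hg i).continuous.pow 2) (hc2 (hpc hgc i))
  have iB : Integrable fun x => (∑ i : Fin 2, partialD i η x ^ 2) * (w x + ε) := by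
    simp only [Finset.sum_mul]
    refine integrable_finsetSum _ fun i _ => hint ?_ (hc2 (hpc hηc i)).mul_right
    exact ((ContDiff.partialD hη i).continuous.pow 2).mul (hw.continuous.add continuous_const)
  have iC : Integrable fun x => R / 2 * (η x ^ 2 * w x ^ 2) :=
    (hint ((hη.continuous.pow 2).mul (hw.continuous.pow 2)) hηc2.mul_right).const_mul _
  have iD : ∀ i : Fin 2, Integrable fun x => (η x * partialD i η x * partialD i w x
      + 1 / 2 * (η x ^ 2 * partialD i (partialD i w) x)) := fun i =>
    (hint ((hη.continuous.mul (ContDiff.partialD hη i).continuous).mul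
      (ContDiff.partialD hw i).continuous) hηc.mul_right.mul_right).add
    ((hint ((hη.continuous.pow 2).mul
      (ContDiff.partialD (ContDiff.partialD hw i) i).continuous) hηc2.mul_right).const_mul _)
  have hdiv : ∫ x, ∑ i : Fin 2, (η x * partialD i η x * partialD i w x
      + 1 / 2 * (η x ^ 2 * partialD i (partialD i w) x)) = 0 := by
    rw [integral_finsetSum _ fun i _ => iD i]
    simp only [integral_sq_mul_partialD_eq_zero hη hηc hw, Finset.sum_const_zero]
  have iBC : Integrable fun x => (∑ i : Fin 2, partialD i η x ^ 2) * (w x + ε)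
      + R / 2 * (η x ^ 2 * w x ^ 2) := iB.add iC
  calc _ ≤ ∫ x, (((∑ i : Fin 2, partialD i η x ^ 2) * (w x + ε) + R / 2 * (η x ^ 2 * w x ^ 2))
          + ∑ i : Fin 2, (η x * partialD i η x * partialD i w x
            + 1 / 2 * (η x ^ 2 * partialD i (partialD i w) x))) := by
        refine integral_mono (integrable_finsetSum _ fun i _ => iA i)
          (iBC.add (integrable_finsetSum _ fun i _ => iD i)) fun x => ?_
        have hs0 : 0 < √(w x + ε) := Real.sqrt_pos.2 (hpos x)
        have hsq : √(w x + ε) ^ 2 = w x + ε := Real.sq_sqrt (hpos x).le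
        have hder : ∀ i : Fin 2, partialD i (fun y => η y * √(w y + ε)) x =
            partialD i η x * √(w x + ε) + η x * (partialD i w x / (2 * √(w x + ε))) := by
          intro i
          have hdw : DifferentiableAt ℝ (fun y => w y + ε) x :=
            (hw.differentiable (by simp) x).add_const ε
          rw [KahlerHarmonic.partialD, fderiv_fun_mul (hη.differentiable (by simp) x)
            (hs.differentiable (by simp) x), fderiv_sqrt hdw (hpos x).ne', fderiv_add_const]
          simp [KahlerHarmonic.partialD]
          ring
        have hsq_der : ∀ i : Fin 2, partialD i (fun y => η y * √(w y + ε)) x ^ 2 =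
            partialD i η x ^ 2 * (w x + ε) + η x * partialD i η x * partialD i w x
              + η x ^ 2 * (partialD i w x ^ 2 / (4 * (w x + ε))) := by
          intro i
          rw [hder]
          generalize √(w x + ε) = s at hs0 hsq
          rw [← hsq]
          field_simp
          ring
        simp only [hsq_der]
        -- Replacing `w` by `w + ε` in `hgrad` uses the sign from `hnn`, which `hgrad` does not give
        -- where `w` vanishes.
        have hlast : (∑ i : Fin 2, partialD i w x ^ 2) / (4 * (w x + ε)) ≤
            1 / 2 * laplace w x + R / 2 * w x ^ 2 := by
          rw [div_le_iff₀ (by linarith [hpos x])]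
          nlinarith [hgrad x, hnn x]
        have := mul_le_mul_of_nonneg_left hlast (sq_nonneg (η x))
        simp only [laplace, Fin.sum_univ_two, add_div] at this ⊢
        linarith
    _ = _ := by
        rw [integral_add iBC (integrable_finsetSum _ fun i _ => iD i), hdiv, add_zero]

/-- Gagliardo–Nirenberg is applied to `η√(w+ε)`, and then `ε → 0`. The weight is `η⁴` on the left
but `η²` on the right, so the right side cannot simply be absorbed. -/
lemma integral_cutoff_pow_four_le {η w : Plane → ℝ} {R : ℝ} (hη : ContDiff ℝ ∞ η)
    (hηc : HasCompactSupport η) (hw : ContDiff ℝ ∞ w) (hw0 : ∀ x, 0 ≤ w x)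
    (hgrad : ∀ x, ∑ i : Fin 2, partialD i w x ^ 2
      ≤ 4 * w x * (1 / 2 * laplace w x + R / 2 * w x ^ 2))
    (hnn : ∀ x, 0 ≤ 1 / 2 * laplace w x + R / 2 * w x ^ 2) :
    ∫ x, η x ^ 4 * w x ^ 2 ≤ (gagliardoNirenberg : ℝ) ^ 4 * ((∫ x, η x ^ 2 * w x) *
      ((∫ x, (∑ i : Fin 2, partialD i η x ^ 2) * w x) + R / 2 * ∫ x, η x ^ 2 * w x ^ 2)) := by
  have hpc : ∀ {f : Plane → ℝ}, HasCompactSupport f → ∀ i : Fin 2,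
      HasCompactSupport (KahlerHarmonic.partialD i f) := fun hf i =>
    (hf.fderiv ℝ).comp_left (g := fun L : Plane →L[ℝ] ℝ => L (EuclideanSpace.single i 1)) (by simp)
  have hint : ∀ {f : Plane → ℝ}, Continuous f → HasCompactSupport f → Integrable f :=
    fun hf hc => hf.integrable_of_hasCompactSupport hc
  have hcn : ∀ {f : Plane → ℝ} (n : ℕ), n ≠ 0 → HasCompactSupport f →
      HasCompactSupport fun x => f x ^ n :=
    fun n hn hf => hf.comp_left (g := fun y : ℝ => y ^ n) (by simp [hn])
  have cη : Continuous η := hη.continuous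
  have cw : Continuous w := hw.continuous
  have cG : Continuous fun x => ∑ i : Fin 2, partialD i η x ^ 2 :=
    continuous_finsetSum _ fun i _ => (ContDiff.partialD hη i).continuous.pow 2
  have sG : HasCompactSupport fun x => ∑ i : Fin 2, partialD i η x ^ 2 := by
    simp only [Fin.sum_univ_two]
    exact (hcn 2 two_ne_zero (hpc hηc 0)).add (hcn 2 two_ne_zero (hpc hηc 1))
  have s2 := hcn 2 two_ne_zero hηc
  have s4 := hcn 4 four_ne_zero hηc
  have key : ∀ ε : ℝ, 0 < ε → ∫ x, η x ^ 4 * w x ^ 2 ≤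
      (gagliardoNirenberg : ℝ) ^ 4 * (((∫ x, η x ^ 2 * w x) + ε * ∫ x, η x ^ 2) *
      (((∫ x, (∑ i : Fin 2, partialD i η x ^ 2) * w x)
        + ε * ∫ x, ∑ i : Fin 2, partialD i η x ^ 2) + R / 2 * ∫ x, η x ^ 2 * w x ^ 2)) := by
    intro ε hε
    have hpos : ∀ x, 0 < w x + ε := fun x => add_pos_of_nonneg_of_pos (hw0 x) hε
    have hs : ContDiff ℝ ∞ fun y => √(w y + ε) :=
      (hw.add contDiff_const).sqrt fun x => (hpos x).ne'
    have h1 := integral_pow_four_le (hη.mul hs) (hηc.mul_right (f' := fun y => √(w y + ε)))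
    have h2 := integral_grad_cutoff_mul_sqrt_le hη hηc hw hw0 hε hgrad hnn
    have e2 : ∀ x, (η x * √(w x + ε)) ^ 2 = η x ^ 2 * w x + ε * η x ^ 2 := fun x => by
      rw [mul_pow, Real.sq_sqrt (hpos x).le]; ring
    have e4 : ∀ x, (η x * √(w x + ε)) ^ 4 = η x ^ 4 * (w x + ε) ^ 2 := fun x => by
      rw [mul_pow, show √(w x + ε) ^ 4 = (√(w x + ε) ^ 2) ^ 2 by ring, Real.sq_sqrt (hpos x).le]
    simp only [e2, e4] at h1
    have h3 : ∫ x, η x ^ 4 * w x ^ 2 ≤ ∫ x, η x ^ 4 * (w x + ε) ^ 2 := by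
      refine integral_mono (hint ((cη.pow 4).mul (cw.pow 2)) s4.mul_right)
        (hint ((cη.pow 4).mul ((cw.add continuous_const).pow 2)) s4.mul_right) fun x => ?_
      have := hw0 x
      dsimp only
      gcongr
      linarith
    refine h3.trans (h1.trans ?_)
    have j1 : Integrable fun x => η x ^ 2 * w x := hint ((cη.pow 2).mul cw) s2.mul_right
    have j2 : Integrable fun x => ε * η x ^ 2 := (hint (cη.pow 2) s2).const_mul _
    have j3 : Integrable fun x => (∑ i : Fin 2, partialD i η x ^ 2) * w x :=
      hint (cG.mul cw) sG.mul_right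
    have j4 : Integrable fun x => ε * ∑ i : Fin 2, partialD i η x ^ 2 := (hint cG sG).const_mul _
    have j5 : Integrable fun x => R / 2 * (η x ^ 2 * w x ^ 2) :=
      (hint ((cη.pow 2).mul (cw.pow 2)) s2.mul_right).const_mul _
    have j34 : Integrable fun x => (∑ i : Fin 2, partialD i η x ^ 2) * w x
      + ε * ∑ i : Fin 2, partialD i η x ^ 2 := j3.add j4
    rw [integral_add j1 j2, integral_const_mul]
    have hI : 0 ≤ (∫ x, η x ^ 2 * w x) + ε * ∫ x, η x ^ 2 :=
      add_nonneg (integral_nonneg fun x => mul_nonneg (sq_nonneg _) (hw0 x))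
        (mul_nonneg hε.le (integral_nonneg fun x => sq_nonneg _))
    refine mul_le_mul_of_nonneg_left (mul_le_mul_of_nonneg_left (h2.trans (le_of_eq ?_)) hI)
      (by positivity)
    have e5 : ∀ x, (∑ i : Fin 2, partialD i η x ^ 2) * (w x + ε) =
        (∑ i : Fin 2, partialD i η x ^ 2) * w x + ε * (∑ i : Fin 2, partialD i η x ^ 2) :=
      fun x => by ring
    simp only [e5]
    rw [integral_add j34 j5, integral_add j3 j4, integral_const_mul, integral_const_mul]
  refine ge_of_tendsto (f := fun ε : ℝ => (gagliardoNirenberg : ℝ) ^ 4 *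
      (((∫ x, η x ^ 2 * w x) + ε * ∫ x, η x ^ 2) *
      (((∫ x, (∑ i : Fin 2, partialD i η x ^ 2) * w x)
        + ε * ∫ x, ∑ i : Fin 2, partialD i η x ^ 2) + R / 2 * ∫ x, η x ^ 2 * w x ^ 2)))
    (x := nhdsWithin 0 (Set.Ioi 0)) ?_ (by filter_upwards [self_mem_nhdsWithin] using key)
  refine tendsto_nhdsWithin_of_tendsto_nhds (Continuous.tendsto' (by fun_prop) _ _ (by simp))

/-- A nonnegative integrable function that satisfies the Bochner inequality and whose integral is
below the threshold given by the Gagliardo-Nirenberg constant vanishes. -/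
theorem eq_zero_of_bochner {w : Plane → ℝ} {R : ℝ} (hR : 0 < R) (hw : ContDiff ℝ ∞ w)
    (hw0 : ∀ x, 0 ≤ w x)
    (hgrad : ∀ x, ∑ i : Fin 2, partialD i w x ^ 2
      ≤ 4 * w x * (1 / 2 * laplace w x + R / 2 * w x ^ 2))
    (hnn : ∀ x, 0 ≤ 1 / 2 * laplace w x + R / 2 * w x ^ 2)
    (hwi : Integrable w) (hsmall : (gagliardoNirenberg : ℝ) ^ 4 * R * ∫ x, w x < 1) :
    ∀ x, w x = 0 := by
  obtain ⟨K, hK0, hK⟩ := exists_cutoff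
  set C : ℝ := (gagliardoNirenberg : ℝ) ^ 4 with hC
  have hC0 : 0 ≤ C := by positivity
  set I : ℝ := ∫ x, w x with hI
  have hI0 : 0 ≤ I := integral_nonneg hw0
  -- Only local integrals of `w²` are known to be finite.
  set Φ : ℝ → ℝ := fun ρ => ∫ x in Metric.closedBall (0 : Plane) ρ, w x ^ 2 with hΦ
  have cw : Continuous w := hw.continuous
  have iΦ : ∀ ρ, IntegrableOn (fun x => w x ^ 2) (Metric.closedBall (0 : Plane) ρ) := fun ρ =>
    (cw.pow 2).continuousOn.integrableOn_compact (isCompact_closedBall 0 ρ)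
  have hΦ0 : ∀ ρ, 0 ≤ Φ ρ := fun ρ => integral_nonneg fun x => sq_nonneg _
  have hΦmono : ∀ {ρ σ}, ρ ≤ σ → Φ ρ ≤ Φ σ := fun h =>
    setIntegral_mono_set (iΦ _) (Filter.Eventually.of_forall fun x => sq_nonneg _)
      (Metric.closedBall_subset_closedBall h).eventuallyLE
  have hstep : ∀ ρ σ, 0 < ρ → ρ < σ →
      Φ ρ ≤ C * (I * ((K / (σ - ρ)) ^ 2 * I + R / 2 * Φ σ)) := by
    intro ρ σ hρ hσ
    obtain ⟨η, hη, hηc, hη0, hη1, hηin, hηout, hηd⟩ := hK ρ σ hρ hσ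
    have cη := hη.continuous
    have hc2 : HasCompactSupport fun x => η x ^ 2 :=
      hηc.comp_left (g := fun y : ℝ => y ^ 2) (by simp)
    have hc4 : HasCompactSupport fun x => η x ^ 4 :=
      hηc.comp_left (g := fun y : ℝ => y ^ 4) (by simp)
    have hsq1 : ∀ x, η x ^ 2 ≤ 1 := fun x => pow_le_one₀ (hη0 x) (hη1 x)
    have i4 : Integrable fun x => η x ^ 4 * w x ^ 2 :=
      ((cη.pow 4).mul (cw.pow 2)).integrable_of_hasCompactSupport hc4.mul_right
    have h1 : Φ ρ ≤ ∫ x, η x ^ 4 * w x ^ 2 := by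
      calc Φ ρ = ∫ x in Metric.closedBall (0 : Plane) ρ, η x ^ 4 * w x ^ 2 :=
            setIntegral_congr_fun measurableSet_closedBall fun x hx => by simp [hηin x hx]
        _ ≤ _ := setIntegral_le_integral i4 (Filter.Eventually.of_forall fun x => by positivity)
    have h2 : ∫ x, η x ^ 2 * w x ≤ I := by
      refine integral_mono ?_ hwi fun x => mul_le_of_le_one_left (hw0 x) (hsq1 x)
      exact ((cη.pow 2).mul cw).integrable_of_hasCompactSupport hc2.mul_right
    have h3 : ∫ x, (∑ i : Fin 2, partialD i η x ^ 2) * w x ≤ (K / (σ - ρ)) ^ 2 * I := by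
      rw [hI, ← integral_const_mul]
      refine integral_mono_of_nonneg (Filter.Eventually.of_forall fun x =>
        mul_nonneg (Finset.sum_nonneg fun i _ => sq_nonneg _) (hw0 x)) (hwi.const_mul _)
        (Filter.Eventually.of_forall fun x => mul_le_mul_of_nonneg_right (hηd x) (hw0 x))
    have h4 : ∫ x, η x ^ 2 * w x ^ 2 ≤ Φ σ := by
      rw [← setIntegral_eq_integral_of_forall_compl_eq_zero
        (s := Metric.closedBall (0 : Plane) σ) fun x hx => by simp [hηout x hx]]
      refine integral_mono ?_ (iΦ σ) fun x => mul_le_of_le_one_left (sq_nonneg _) (hsq1 x)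
      exact (((cη.pow 2).mul (cw.pow 2)).integrable_of_hasCompactSupport
        hc2.mul_right).integrableOn
    have h5 : 0 ≤ ∫ x, η x ^ 2 * w x := integral_nonneg fun x => mul_nonneg (sq_nonneg _) (hw0 x)
    refine h1.trans ((integral_cutoff_pow_four_le hη hηc hw hw0 hgrad hnn).trans ?_)
    refine mul_le_mul_of_nonneg_left ?_ hC0
    have h6 : 0 ≤ (K / (σ - ρ)) ^ 2 * I + R / 2 * Φ σ := by
      have := hΦ0 σ
      positivity
    calc _ ≤ (∫ x, η x ^ 2 * w x) * ((K / (σ - ρ)) ^ 2 * I + R / 2 * Φ σ) := by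
          refine mul_le_mul_of_nonneg_left ?_ h5
          gcongr
      _ ≤ _ := mul_le_mul_of_nonneg_right h2 h6
  set A : ℝ := C * I * K ^ 2 * I with hA
  have hA0 : 0 ≤ A := by positivity
  -- The bound does not depend on `r`, so `r → ∞` with `ρ` fixed will give `Φ ρ = 0`.
  have hdecay : ∀ r, 0 < r → ∀ ρ, 0 < ρ → ρ < r → (r - ρ) ^ 2 * Φ ρ ≤ 200 * A := by
    intro r hr
    set S : Set ℝ := (fun ρ => (r - ρ) ^ 2 * Φ ρ) '' Set.Ioo 0 r with hS
    -- Finiteness of the supremum is what permits subtracting `25 / 32 * sSup S` from both sides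
    -- later.
    have hSb : BddAbove S := by
      refine ⟨r ^ 2 * Φ r, ?_⟩
      rintro _ ⟨ρ, ⟨h0, h1⟩, rfl⟩
      have : (r - ρ) ^ 2 ≤ r ^ 2 := by nlinarith
      exact mul_le_mul this (hΦmono h1.le) (hΦ0 _) (by positivity)
    have hSne : S.Nonempty := ⟨_, r / 2, ⟨by linarith, by linarith⟩, rfl⟩
    have hsup : sSup S ≤ 25 * A + 25 / 32 * sSup S := by
      refine csSup_le hSne ?_
      rintro _ ⟨ρ, ⟨h0, h1⟩, rfl⟩
      have hd : 0 < r - ρ := sub_pos.2 h1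
      -- Passing from `ρ` to `σ` costs a factor `25/16` in the weight `(r - ρ)²`. Multiplied by `C *
      -- R * I / 2 < 1/2` it stays below `25/32 < 1`. Absorption then gives `sSup S ≤ (800/7) A ≤
      -- 200 A`.
      set σ := ρ + (r - ρ) / 5 with hσ
      have hst := hstep ρ σ h0 (by linarith)
      have hmem : (r - σ) ^ 2 * Φ σ ≤ sSup S :=
        le_csSup hSb ⟨σ, ⟨by linarith, by linarith⟩, rfl⟩
      have e1 : σ - ρ = (r - ρ) / 5 := by rw [hσ]; ring
      have e2 : (r - σ) ^ 2 = 16 / 25 * (r - ρ) ^ 2 := by rw [hσ]; ring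
      rw [e2] at hmem
      rw [e1] at hst
      have h7 : (r - ρ) ^ 2 * Φ ρ ≤ 25 * A + C * R * I / 2 * ((r - ρ) ^ 2 * Φ σ) := by
        calc _ ≤ (r - ρ) ^ 2 * (C * (I * ((K / ((r - ρ) / 5)) ^ 2 * I + R / 2 * Φ σ))) := by gcongr
          _ = _ := by rw [hA]; field_simp; ring
      have h8 : 0 ≤ (r - ρ) ^ 2 * Φ σ := mul_nonneg (sq_nonneg _) (hΦ0 _)
      dsimp only
      nlinarith
    intro ρ h0 h1
    have := le_csSup hSb ⟨ρ, ⟨h0, h1⟩, rfl⟩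
    dsimp only at this
    linarith
  have hΦzero : ∀ ρ, 0 < ρ → Φ ρ = 0 := by
    intro ρ hρ
    refine le_antisymm ?_ (hΦ0 ρ)
    have h1 : ∀ᶠ r : ℝ in Filter.atTop, Φ ρ ≤ 200 * A / (r - ρ) ^ 2 := by
      filter_upwards [Filter.eventually_gt_atTop ρ] with r hr
      rw [le_div_iff₀ (by have := sub_pos.2 hr; positivity), mul_comm]
      exact hdecay r (hρ.trans hr) ρ hρ hr
    refine ge_of_tendsto ?_ h1
    refine Filter.Tendsto.div_atTop tendsto_const_nhds ?_
    exact (Filter.tendsto_pow_atTop two_ne_zero).comp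
      (Filter.tendsto_atTop_add_const_right _ (-ρ) Filter.tendsto_id)
  -- The integral of `w²` over a ball around the origin containing `x` is zero, so the continuous
  -- function `w²` vanishes on the open ball.
  intro x
  by_contra hx
  have hpos : 0 < w x ^ 2 := by positivity
  have hzero := hΦzero (‖x‖ + 1) (by positivity)
  have hae := (setIntegral_eq_zero_iff_of_nonneg_ae
    (Filter.Eventually.of_forall fun x => sq_nonneg _) (iΦ (‖x‖ + 1))).1 hzero
  have hae' : ∀ᵐ y ∂volume.restrict (Metric.ball (0 : Plane) (‖x‖ + 1)), w y ^ 2 = 0 :=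
    ae_restrict_of_ae_restrict_of_subset Metric.ball_subset_closedBall hae
  have := Measure.eqOn_open_of_ae_eq (μ := volume) (f := fun y => w y ^ 2) (g := fun _ => 0)
    hae' Metric.isOpen_ball (cw.pow 2).continuousOn continuousOn_const
  exact hpos.ne' (this (by simp : x ∈ Metric.ball (0 : Plane) (‖x‖ + 1)))

end Laplacian

/-! ### The Levi-Civita connection and curvature in a chart -/

section LeviCivita

variable {E : Type*} [NormedAddCommGroup E] [NormedSpace ℝ E]

/-- The Christoffel symbol as a continuous bilinear map. -/
def christoffelCLM (G : E → E →L[ℝ] E →L[ℝ] ℝ) (y : E) : E →L[ℝ] E →L[ℝ] E :=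
  (ContinuousLinearMap.compL ℝ E (E →L[ℝ] ℝ) E (G y).inverse) ∘L
    ((1 / 2 : ℝ) • (fderiv ℝ G y + (fderiv ℝ G y).flip
      - ((ContinuousLinearMap.flipₗᵢ ℝ E E ℝ).toContinuousLinearEquiv.toContinuousLinearMap) ∘L
        (fderiv ℝ G y).flip))

lemma christoffelCLM_apply (G : E → E →L[ℝ] E →L[ℝ] ℝ) (y v w : E) :
    christoffelCLM G y v w = christoffel G y v w := rfl

/-- `G` is a smooth Riemannian metric on the open set `U`. -/
structure IsMetricOn (G : E → E →L[ℝ] E →L[ℝ] ℝ) (U : Set E) : Prop where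
  isOpen : IsOpen U
  smooth : ∀ y ∈ U, ContDiffAt ℝ ∞ G y
  symm : ∀ y ∈ U, ∀ v w, G y v w = G y w v
  pos : ∀ y ∈ U, ∀ v, v ≠ 0 → 0 < G y v v

namespace IsMetricOn

variable {G : E → E →L[ℝ] E →L[ℝ] ℝ} {U : Set E} (hG : IsMetricOn G U)
include hG

lemma nonneg {y : E} (hy : y ∈ U) (v : E) : 0 ≤ G y v v := by
  rcases eq_or_ne v 0 with rfl | hv
  · simp
  · exact (hG.pos y hy v hv).le

lemma fderiv_symm {y : E} (hy : y ∈ U) (z v w : E) :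
    fderiv ℝ G y z v w = fderiv ℝ G y z w v := by
  have hd : DifferentiableAt ℝ G y := (hG.smooth y hy).differentiableAt (by simp)
  have h : ∀ a b : E, fderiv ℝ (fun y' => G y' a b) y z = fderiv ℝ G y z a b := by
    intro a b
    rw [fderiv_clm_apply (hd.clm_apply (differentiableAt_const a)) (differentiableAt_const b),
      fderiv_clm_apply hd (differentiableAt_const a)]
    simp
  rw [← h, ← h]
  refine congrArg (fun L : E →L[ℝ] ℝ => L z) (Filter.EventuallyEq.fderiv_eq ?_)
  filter_upwards [hG.isOpen.mem_nhds hy] with y' hy' using hG.symm y' hy' v w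

variable [FiniteDimensional ℝ E]

/-- Positivity gives injectivity, and equal dimensions give bijectivity. Hence `(G y).inverse` is a
true inverse and not the default value `0`. -/
lemma exists_equiv {y : E} (hy : y ∈ U) : ∃ e : E ≃L[ℝ] (E →L[ℝ] ℝ), (e : E →L[ℝ] E →L[ℝ] ℝ) = G y := by
  have hinj : Function.Injective (G y) := by
    rw [injective_iff_map_eq_zero]
    intro v hv
    by_contra hne
    have := hG.pos y hy v hne
    simp [hv] at this
  have hdim : Module.finrank ℝ E = Module.finrank ℝ (E →L[ℝ] ℝ) := by
    rw [← LinearMap.toContinuousLinearMap.finrank_eq, Subspace.dual_finrank_eq]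
  refine ⟨(LinearEquiv.ofInjectiveOfFinrankEq (G y : E →ₗ[ℝ] E →L[ℝ] ℝ) hinj
    hdim).toContinuousLinearEquiv, ?_⟩
  ext v w
  rfl

lemma metric_christoffel {y : E} (hy : y ∈ U) (v w z : E) :
    G y (christoffel G y v w) z =
      1 / 2 * (fderiv ℝ G y v w z + fderiv ℝ G y w v z - fderiv ℝ G y z v w) := by
  obtain ⟨e, he⟩ := hG.exists_equiv hy
  rw [christoffel, ← he, ContinuousLinearMap.inverse_equiv]
  simp

lemma christoffel_symm {y : E} (hy : y ∈ U) (v w : E) :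
    christoffel G y v w = christoffel G y w v := by
  obtain ⟨e, he⟩ := hG.exists_equiv hy
  refine e.injective ?_
  change (e : E →L[ℝ] E →L[ℝ] ℝ) _ = (e : E →L[ℝ] E →L[ℝ] ℝ) _
  rw [he]
  ext z
  rw [hG.metric_christoffel hy, hG.metric_christoffel hy, hG.fderiv_symm hy z v w]
  ring

/-- Metric compatibility: in the sum of two Koszul formulas all but the wanted derivative cancel by
symmetry. -/
lemma fderiv_metric {y : E} (hy : y ∈ U) (z v w : E) :
    fderiv ℝ G y z v w = G y (christoffel G y z v) w + G y v (christoffel G y z w) := by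
  rw [hG.symm y hy v, hG.metric_christoffel hy, hG.metric_christoffel hy,
    hG.fderiv_symm hy z w v, hG.fderiv_symm hy w z v, hG.fderiv_symm hy v z w]
  ring

lemma contDiffAt_christoffelCLM {y : E} (hy : y ∈ U) : ContDiffAt ℝ ∞ (christoffelCLM G) y := by
  have : CompleteSpace E := FiniteDimensional.complete ℝ E
  obtain ⟨e, he⟩ := hG.exists_equiv hy
  have h0 : ContDiffAt ℝ ∞
      (ContinuousLinearMap.inverse : (E →L[ℝ] E →L[ℝ] ℝ) → (E →L[ℝ] ℝ) →L[ℝ] E) (G y) := by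
    rw [← he]
    exact contDiffAt_map_inverse e
  have h1 : ContDiffAt ℝ ∞ (fun y => (G y).inverse) y := h0.comp y (hG.smooth y hy)
  have h2 : ContDiffAt ℝ ∞ (fderiv ℝ G) y := (hG.smooth y hy).fderiv_right (by simp)
  have h3 : ContDiffAt ℝ ∞ (fun y => (fderiv ℝ G y).flip) y :=
    (ContinuousLinearMap.flipₗᵢ ℝ E E (E →L[ℝ] ℝ)).toContinuousLinearEquiv.contDiff.contDiffAt.comp
      y h2
  refine ContDiffAt.clm_comp ?_ ((contDiffAt_const (c := (1 / 2 : ℝ))).smul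
    ((h2.add h3).sub (contDiffAt_const.clm_comp h3)))
  exact (ContinuousLinearMap.compL ℝ E (E →L[ℝ] ℝ) E).contDiff.contDiffAt.comp y h1

end IsMetricOn

/-- In this form the curvature is visibly linear in each argument and continuous in the base point.
-/
lemma curvature_eq_of_differentiableAt {G : E → E →L[ℝ] E →L[ℝ] ℝ} {y : E}
    (hd : DifferentiableAt ℝ (christoffelCLM G) y) (v w z : E) :
    curvature G y v w z = fderiv ℝ (christoffelCLM G) y v w z
      - fderiv ℝ (christoffelCLM G) y w v z
      + christoffelCLM G y v (christoffelCLM G y w z)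
      - christoffelCLM G y w (christoffelCLM G y v z) := by
  have h : ∀ a b c : E, fderiv ℝ (fun y' => christoffel G y' a b) y c
      = fderiv ℝ (christoffelCLM G) y c a b := by
    intro a b c
    simp only [← christoffelCLM_apply]
    rw [fderiv_clm_apply (hd.clm_apply (differentiableAt_const a)) (differentiableAt_const b),
      fderiv_clm_apply hd (differentiableAt_const a)]
    simp
  simp only [curvature, h, christoffelCLM_apply]

end LeviCivita

/-! ### Covariant derivatives along a map and the Bochner inequality -/

section AlongMap

variable {E : Type*} [NormedAddCommGroup E] [NormedSpace ℝ E]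

lemma partialD_comp_bilinear {F : Type*} [NormedAddCommGroup F] [NormedSpace ℝ F]
    {A : E → E →L[ℝ] E →L[ℝ] F} {u V W : Plane → E} {x : Plane}
    (hA : DifferentiableAt ℝ A (u x)) (hu : DifferentiableAt ℝ u x)
    (hV : DifferentiableAt ℝ V x) (hW : DifferentiableAt ℝ W x) (i : Fin 2) :
    partialD i (fun x => A (u x) (V x) (W x)) x =
      fderiv ℝ A (u x) (partialD i u x) (V x) (W x) + A (u x) (partialD i V x) (W x)
        + A (u x) (V x) (partialD i W x) := by
  have hAu : DifferentiableAt ℝ (fun x => A (u x)) x := hA.comp x hu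
  have hc : fderiv ℝ (fun x => A (u x)) x = fderiv ℝ A (u x) ∘L fderiv ℝ u x :=
    fderiv_comp x hA hu
  rw [partialD, fderiv_clm_apply (hAu.clm_apply hV) hW, fderiv_clm_apply hAu hV, hc]
  simp only [partialD, add_apply, ContinuousLinearMap.comp_apply,
    ContinuousLinearMap.flip_apply]
  abel

lemma ContDiffAt.partialD {F : Type*} [NormedAddCommGroup F] [NormedSpace ℝ F]
    {V : Plane → F} {x : Plane} (hV : ContDiffAt ℝ ∞ V x) (i : Fin 2) :
    ContDiffAt ℝ ∞ (partialD i V) x :=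
  (hV.fderiv_right (m := ∞) (by simp)).clm_apply contDiffAt_const

lemma partialD_comm {F : Type*} [NormedAddCommGroup F] [NormedSpace ℝ F]
    {V : Plane → F} {x : Plane} (hV : ContDiffAt ℝ ∞ V x) (i j : Fin 2) :
    partialD i (partialD j V) x = partialD j (partialD i V) x := by
  have hd : DifferentiableAt ℝ (fderiv ℝ V) x :=
    (hV.fderiv_right (m := ∞) (by simp)).differentiableAt (by simp)
  have h : ∀ a b : Fin 2, partialD a (partialD b V) x =
      fderiv ℝ (fderiv ℝ V) x (EuclideanSpace.single a 1) (EuclideanSpace.single b 1) := by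
    intro a b
    change fderiv ℝ (fun x => fderiv ℝ V x (EuclideanSpace.single b 1)) x _ = _
    rw [fderiv_clm_apply hd (differentiableAt_const _)]
    simp
  rw [h, h]
  refine (hV.isSymmSndFDerivAt ?_).eq _ _
  rw [minSmoothness_of_isRCLikeNormedField]
  exact WithTop.coe_le_coe.2 le_top

lemma _root_.Filter.EventuallyEq.partialD_eq {F : Type*} [NormedAddCommGroup F] [NormedSpace ℝ F]
    {V W : Plane → F} {x : Plane} (h : V =ᶠ[nhds x] W) (i : Fin 2) :
    partialD i V x = partialD i W x := by
  rw [partialD, partialD, h.fderiv_eq]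

lemma _root_.Filter.EventuallyEq.covAlong_eq {G : E → E →L[ℝ] E →L[ℝ] ℝ} {u V W : Plane → E}
    {x : Plane} (h : V =ᶠ[nhds x] W) (i : Fin 2) : covAlong G u i V x = covAlong G u i W x := by
  rw [covAlong, covAlong, h.partialD_eq, h.eq_of_nhds]

lemma covAlong_add {G : E → E →L[ℝ] E →L[ℝ] ℝ} {u V W : Plane → E} {x : Plane}
    (hV : DifferentiableAt ℝ V x) (hW : DifferentiableAt ℝ W x) (i : Fin 2) :
    covAlong G u i (fun x => V x + W x) x = covAlong G u i V x + covAlong G u i W x := by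
  simp only [covAlong, partialD, fderiv_fun_add hV hW, ← christoffelCLM_apply, map_add,
    add_apply]
  abel

variable [FiniteDimensional ℝ E] {G : E → E →L[ℝ] E →L[ℝ] ℝ} {U : Set E} {u : Plane → E}
  {x : Plane}

namespace IsMetricOn

variable (hG : IsMetricOn G U) (hu : ContDiffAt ℝ ∞ u x) (hx : u x ∈ U)
include hG hu hx

lemma contDiffAt_covAlong {V : Plane → E} (hV : ContDiffAt ℝ ∞ V x) (i : Fin 2) :
    ContDiffAt ℝ ∞ (covAlong G u i V) x :=
  (ContDiffAt.partialD hV i).add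
    ((((hG.contDiffAt_christoffelCLM hx).comp x hu).clm_apply (ContDiffAt.partialD hu i)).clm_apply
      hV)

lemma partialD_metric {V W : Plane → E} (hV : DifferentiableAt ℝ V x)
    (hW : DifferentiableAt ℝ W x) (i : Fin 2) :
    partialD i (fun x => G (u x) (V x) (W x)) x =
      G (u x) (covAlong G u i V x) (W x) + G (u x) (V x) (covAlong G u i W x) := by
  rw [partialD_comp_bilinear ((hG.smooth _ hx).differentiableAt (by simp))
    (hu.differentiableAt (by simp)) hV hW, hG.fderiv_metric hx]
  simp only [covAlong, map_add, add_apply]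
  ring

/-- The connection is torsion-free and second partial derivatives commute. -/
lemma covAlong_partialD_comm (i j : Fin 2) :
    covAlong G u i (partialD j u) x = covAlong G u j (partialD i u) x := by
  rw [covAlong, covAlong, partialD_comm hu i j, hG.christoffel_symm hx]

/-- Second derivatives of `u` and `V` cancel by symmetry; what survives is the derivative of the
Christoffel symbol and its quadratic terms. -/
lemma covAlong_commutator {V : Plane → E} (hV : ContDiffAt ℝ ∞ V x) (i j : Fin 2) :
    covAlong G u i (covAlong G u j V) x = covAlong G u j (covAlong G u i V) x
      + curvature G (u x) (partialD i u x) (partialD j u x) (V x) := by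
  have hΓ := (hG.contDiffAt_christoffelCLM hx).differentiableAt (by simp)
  have h : ∀ a b : Fin 2, partialD a (covAlong G u b V) x =
      partialD a (partialD b V) x
        + (fderiv ℝ (christoffelCLM G) (u x) (partialD a u x) (partialD b u x) (V x)
          + christoffelCLM G (u x) (partialD a (partialD b u) x) (V x)
          + christoffelCLM G (u x) (partialD b u x) (partialD a V x)) := by
    intro a b
    have hub := ContDiffAt.partialD hu b
    rw [← partialD_comp_bilinear hΓ (hu.differentiableAt (by simp))
      (hub.differentiableAt (by simp)) (hV.differentiableAt (by simp))]
    have h1 : DifferentiableAt ℝ (partialD b V) x :=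
      (ContDiffAt.partialD hV b).differentiableAt (by simp)
    have h2 : DifferentiableAt ℝ
        (fun x => christoffelCLM G (u x) (partialD b u x) (V x)) x :=
      ((((hG.contDiffAt_christoffelCLM hx).comp x hu).clm_apply hub).clm_apply
        hV).differentiableAt (by simp)
    change fderiv ℝ (fun x => partialD b V x
      + christoffelCLM G (u x) (partialD b u x) (V x)) x _ = _
    rw [fderiv_fun_add h1 h2]
    rfl
  rw [covAlong, h, covAlong.eq_def G u j (covAlong G u i V), h,
    curvature_eq_of_differentiableAt hΓ, partialD_comm hV i j, partialD_comm hu i j]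
  simp only [covAlong, ← christoffelCLM_apply, map_add]
  abel

end IsMetricOn

omit [FiniteDimensional ℝ E] in
/-- The Cauchy-Schwarz inequality for pairs of vectors. -/
lemma sq_sum_inner_le (hG : IsMetricOn G U) {y : E} (hy : y ∈ U) (a b : Fin 2 → E) :
    (∑ i, G y (a i) (b i)) ^ 2 ≤ (∑ i, G y (a i) (a i)) * ∑ i, G y (b i) (b i) := by
  have h : ∀ t : ℝ, 0 ≤ (∑ i, G y (a i) (a i)) * (t * t)
      + (2 * ∑ i, G y (a i) (b i)) * t + ∑ i, G y (b i) (b i) := by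
    intro t
    have : 0 ≤ ∑ i, G y (t • a i + b i) (t • a i + b i) :=
      Finset.sum_nonneg fun i _ => hG.nonneg hy _
    simp only [map_add, map_smul, add_apply, smul_apply,
      smul_eq_mul, Fin.sum_univ_two, hG.symm y hy (b 0), hG.symm y hy (b 1)] at this ⊢
    linarith
  have := discrim_le_zero h
  rw [discrim] at this
  linarith

/-- The Bochner inequality for harmonic maps from the plane, read in a chart of the target. -/
theorem bochner (hG : IsMetricOn G U) {Ω : Set Plane} (hΩ : IsOpen Ω)
    (hu : ∀ x ∈ Ω, ContDiffAt ℝ ∞ u x) (hmap : ∀ x ∈ Ω, u x ∈ U)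
    (ht : ∀ x ∈ Ω, tension G u x = 0) (hx : x ∈ Ω) {R : ℝ} (hR : 0 ≤ R)
    (hK : ∀ v w, G (u x) (curvature G (u x) v w w) v ≤ R * (G (u x) v v * G (u x) w w))
    {e : Plane → ℝ} (he : e = fun x => ∑ i, G (u x) (partialD i u x) (partialD i u x)) :
    ∑ j, partialD j e x ^ 2 ≤ 4 * e x * (1 / 2 * laplace e x + R / 2 * e x ^ 2) ∧
      0 ≤ 1 / 2 * laplace e x + R / 2 * e x ^ 2 := by
  have hev : ∀ᶠ z in nhds x, z ∈ Ω := hΩ.mem_nhds hx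
  have hdu : ∀ z ∈ Ω, ∀ i, DifferentiableAt ℝ (partialD i u) z := fun z hz i =>
    (ContDiffAt.partialD (hu z hz) i).differentiableAt (by simp)
  have hcov : ∀ z ∈ Ω, ∀ i j, ContDiffAt ℝ ∞ (covAlong G u j (partialD i u)) z :=
    fun z hz i j =>
      hG.contDiffAt_covAlong (hu z hz) (hmap z hz) (ContDiffAt.partialD (hu z hz) i) j
  have hmetdiff : ∀ z ∈ Ω, ∀ V W : Plane → E, DifferentiableAt ℝ V z → DifferentiableAt ℝ W z →
      DifferentiableAt ℝ (fun z => G (u z) (V z) (W z)) z := fun z hz V W hV hW =>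
    ((((hG.smooth _ (hmap z hz)).comp z (hu z hz)).differentiableAt (by simp)).clm_apply
      hV).clm_apply hW
  have hgrad : ∀ z ∈ Ω, ∀ j, partialD j e z =
      2 * ∑ i, G (u z) (covAlong G u j (partialD i u) z) (partialD i u z) := by
    intro z hz j
    rw [he, partialD, fderiv_fun_sum fun i _ => hmetdiff z hz _ _ (hdu z hz i) (hdu z hz i),
      sum_apply, Finset.mul_sum]
    refine Finset.sum_congr rfl fun i _ => ?_
    have := hG.partialD_metric (hu z hz) (hmap z hz) (hdu z hz i) (hdu z hz i) j
    rw [hG.symm _ (hmap z hz) (partialD i u z), ← two_mul] at this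
    exact this
  have hhess : ∀ j, partialD j (partialD j e) x =
      2 * ∑ i, (G (u x) (covAlong G u j (covAlong G u j (partialD i u)) x) (partialD i u x)
        + G (u x) (covAlong G u j (partialD i u) x) (covAlong G u j (partialD i u) x)) := by
    intro j
    have h1 : partialD j e =ᶠ[nhds x] fun z =>
        2 * ∑ i, G (u z) (covAlong G u j (partialD i u) z) (partialD i u z) :=
      hev.mono fun z hz => hgrad z hz j
    have hd : ∀ i, DifferentiableAt ℝ
        (fun z => G (u z) (covAlong G u j (partialD i u) z) (partialD i u z)) x := fun i =>
      hmetdiff x hx _ _ ((hcov x hx i j).differentiableAt (by simp)) (hdu x hx i)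
    rw [h1.partialD_eq, partialD, fderiv_const_mul (DifferentiableAt.fun_sum fun i _ => hd i),
      fderiv_fun_sum fun i _ => hd i, smul_apply,
      sum_apply, smul_eq_mul]
    congr 1
    refine Finset.sum_congr rfl fun i _ => ?_
    exact hG.partialD_metric (hu x hx) (hmap x hx) ((hcov x hx i j).differentiableAt (by simp))
      (hdu x hx i) j
  -- The tension vanishes on a neighbourhood, so it may be differentiated.
  have htens : ∀ i, ∑ j, covAlong G u i (covAlong G u j (partialD j u)) x = 0 := by
    intro i
    have h1 : (fun z => covAlong G u 0 (partialD 0 u) z + covAlong G u 1 (partialD 1 u) z)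
        =ᶠ[nhds x] fun _ => 0 := by
      filter_upwards [hev] with z hz
      simpa [tension] using ht z hz
    rw [Fin.sum_univ_two, ← covAlong_add ((hcov x hx 0 0).differentiableAt (by simp))
      ((hcov x hx 1 1).differentiableAt (by simp)), h1.covAlong_eq, covAlong,
      ← christoffelCLM_apply]
    simp [partialD]
  -- `∇_j∇_j∂_i u = ∇_j∇_i∂_j u = ∇_i∇_j∂_j u + R(∂_j u, ∂_i u)∂_j u`; summing over `j` removes the
  -- middle term by `htens`.
  have hrough : ∀ i, ∑ j, covAlong G u j (covAlong G u j (partialD i u)) x =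
      ∑ j, curvature G (u x) (partialD j u x) (partialD i u x) (partialD j u x) := by
    intro i
    rw [← zero_add (∑ j, curvature _ _ _ _ _), ← htens i, ← Finset.sum_add_distrib]
    refine Finset.sum_congr rfl fun j _ => ?_
    rw [← hG.covAlong_commutator (hu x hx) (hmap x hx) (ContDiffAt.partialD (hu x hx) j)]
    refine Filter.EventuallyEq.covAlong_eq ?_ j
    filter_upwards [hev] with z hz using hG.covAlong_partialD_comm (hu z hz) (hmap z hz) j i
  have hlap : 1 / 2 * laplace e x =
      ∑ i, G (u x) (∑ j, curvature G (u x) (partialD j u x) (partialD i u x) (partialD j u x))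
        (partialD i u x)
      + ∑ j, ∑ i,
        G (u x) (covAlong G u j (partialD i u) x) (covAlong G u j (partialD i u) x) := by
    simp only [← hrough, laplace, hhess, Fin.sum_univ_two, map_add,
      add_apply]
    ring
  have hanti : ∀ v w z, curvature G (u x) v w z = -curvature G (u x) w v z := by
    intro v w z
    simp only [curvature]
    abel
  have hself : ∀ v z, curvature G (u x) v v z = 0 := by
    intro v z
    simp only [curvature]
    abel
  set D := ∑ j, ∑ i,
    G (u x) (covAlong G u j (partialD i u) x) (covAlong G u j (partialD i u) x) with hD
  have hD0 : 0 ≤ D := Finset.sum_nonneg fun j _ => Finset.sum_nonneg fun i _ =>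
    hG.nonneg (hmap x hx) _
  have hex : e x = ∑ i, G (u x) (partialD i u x) (partialD i u x) := by rw [he]
  have he0 : 0 ≤ e x := by
    rw [hex]
    exact Finset.sum_nonneg fun i _ => hG.nonneg (hmap x hx) _
  -- Only the terms `i ≠ j` survive. Using `hK` in both orders avoids the pair symmetry of the
  -- curvature tensor; the rest is `2ab ≤ ½ (a + b)²` for the two squared lengths.
  have hDle : D ≤ 1 / 2 * laplace e x + R / 2 * e x ^ 2 := by
    have h1 := hK (partialD 0 u x) (partialD 1 u x)
    have h2 := hK (partialD 1 u x) (partialD 0 u x)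
    rw [hlap, hex]
    simp only [Fin.sum_univ_two, hself, zero_add, add_zero]
    rw [hanti (partialD 1 u x) (partialD 0 u x) (partialD 1 u x),
      hanti (partialD 0 u x) (partialD 1 u x) (partialD 0 u x)]
    simp only [map_neg, neg_apply]
    have h3 := mul_nonneg hR (sq_nonneg (G (u x) (partialD 0 u x) (partialD 0 u x)
      - G (u x) (partialD 1 u x) (partialD 1 u x)))
    linarith
  refine ⟨?_, hD0.trans hDle⟩
  calc ∑ j, partialD j e x ^ 2
      ≤ ∑ j, 4 * ((∑ i, G (u x) (covAlong G u j (partialD i u) x)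
          (covAlong G u j (partialD i u) x)) * e x) := by
        refine Finset.sum_le_sum fun j _ => ?_
        rw [hgrad x hx, mul_pow, hex]
        have := sq_sum_inner_le hG (hmap x hx) (fun i => covAlong G u j (partialD i u) x)
          (fun i => partialD i u x)
        linarith
    _ = 4 * e x * D := by rw [← Finset.mul_sum, ← Finset.sum_mul]; ring
    _ ≤ _ := mul_le_mul_of_nonneg_left hDle (by positivity)

end AlongMap

/-! ### The metric read in charts -/

section Charts

variable {E : Type*} [NormedAddCommGroup E] [NormedSpace ℝ E]
  {N : Type*} [TopologicalSpace N] [ChartedSpace E N]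

lemma metricInChart_apply [IsManifold 𝓘(ℝ, E) ∞ N] (h : Metric E N)
    (e : OpenPartialHomeomorph N E) (y v w : E) :
    metricInChart h e y v w = h.inner (e.symm y) (mfderiv 𝓘(ℝ, E) 𝓘(ℝ, E) e.symm y v)
      (mfderiv 𝓘(ℝ, E) 𝓘(ℝ, E) e.symm y w) := rfl

lemma mdifferentiable_of_mem_atlas [IsManifold 𝓘(ℝ, E) ∞ N] {e : OpenPartialHomeomorph N E}
    (he : e ∈ atlas E N) : e.MDifferentiable 𝓘(ℝ, E) 𝓘(ℝ, E) := by
  have : IsManifold 𝓘(ℝ, E) 1 N := IsManifold.of_le (n := ∞) (by simp)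
  exact _root_.mdifferentiable_of_mem_atlas he

/-- A coordinate vector field is the image of a constant field under the tangent map of `e.symm`. -/
lemma contMDiffOn_mfderiv_symm [IsManifold 𝓘(ℝ, E) ∞ N] {e : OpenPartialHomeomorph N E}
    (he : e ∈ atlas E N) (v : E) :
    ContMDiffOn 𝓘(ℝ, E) 𝓘(ℝ, E).tangent ∞ (fun y : E => Bundle.TotalSpace.mk' E
      (E := fun p : N => TangentSpace 𝓘(ℝ, E) p) (e.symm y)
      (mfderiv 𝓘(ℝ, E) 𝓘(ℝ, E) e.symm y v)) e.target := by
  have h1 : ContMDiffOn 𝓘(ℝ, E) 𝓘(ℝ, E) ∞ e.symm e.target :=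
    contMDiffOn_symm_of_mem_maximalAtlas (IsManifold.subset_maximalAtlas he)
  have h2 := h1.contMDiffOn_tangentMapWithin (m := ∞) (by simp) e.open_target.uniqueMDiffOn
  have h3 : ContMDiffOn 𝓘(ℝ, E) 𝓘(ℝ, E).tangent ∞
      (fun y : E => (⟨y, v⟩ : TangentBundle 𝓘(ℝ, E) E)) e.target :=
    contMDiffOn_vectorSpace_iff_contDiffOn.2 contDiffOn_const
  refine (h2.comp h3 fun y hy => hy).congr fun y hy => ?_
  simp only [Function.comp, tangentMapWithin,
    mfderivWithin_of_mem_nhds (e.open_target.mem_nhds hy)]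

lemma contDiffOn_metricInChart_apply [IsManifold 𝓘(ℝ, E) ∞ N] (h : Metric E N)
    {e : OpenPartialHomeomorph N E} (he : e ∈ atlas E N) (v w : E) :
    ContDiffOn ℝ ∞ (fun y => metricInChart h e y v w) e.target := by
  rw [← contMDiffOn_iff_contDiffOn]
  intro y hy
  have hsymm : ContMDiffOn 𝓘(ℝ, E) 𝓘(ℝ, E) ∞ e.symm e.target :=
    contMDiffOn_symm_of_mem_maximalAtlas (IsManifold.subset_maximalAtlas he)
  have key : ContMDiffWithinAt 𝓘(ℝ, E) (𝓘(ℝ, E).prod 𝓘(ℝ)) ∞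
      (fun y => Bundle.TotalSpace.mk' ℝ (E := Bundle.Trivial N ℝ) (e.symm y)
        (h.inner (e.symm y) (mfderiv 𝓘(ℝ, E) 𝓘(ℝ, E) e.symm y v)
          (mfderiv 𝓘(ℝ, E) 𝓘(ℝ, E) e.symm y w))) e.target y := by
    apply ContMDiffWithinAt.clm_bundle_apply₂ (F₁ := E) (F₂ := E)
    · exact ContMDiffAt.comp_contMDiffWithinAt y h.contMDiff.contMDiffAt (hsymm y hy)
    · exact contMDiffOn_mfderiv_symm he v y hy
    · exact contMDiffOn_mfderiv_symm he w y hy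
  rw [Bundle.contMDiffWithinAt_totalSpace] at key
  exact key.2

lemma contDiffOn_metricInChart [FiniteDimensional ℝ E] [IsManifold 𝓘(ℝ, E) ∞ N]
    (h : Metric E N) {e : OpenPartialHomeomorph N E} (he : e ∈ atlas E N) :
    ContDiffOn ℝ ∞ (metricInChart h e) e.target :=
  contDiffOn_clm_apply.2 fun v => contDiffOn_clm_apply.2 fun w =>
    contDiffOn_metricInChart_apply h he v w

lemma metricInChart_self_pos [IsManifold 𝓘(ℝ, E) ∞ N] (h : Metric E N)
    {e : OpenPartialHomeomorph N E} (he : e ∈ atlas E N) {y v : E} (hy : y ∈ e.target)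
    (hv : v ≠ 0) : 0 < metricInChart h e y v v := by
  rw [metricInChart_apply]
  refine h.pos _ _ fun h0 => hv ?_
  have hinj := (mdifferentiable_of_mem_atlas he).symm.mfderiv_injective hy
  exact hinj (h0.trans (map_zero _).symm)

lemma metricInChart_symm [IsManifold 𝓘(ℝ, E) ∞ N] (h : Metric E N)
    (e : OpenPartialHomeomorph N E) (y v w : E) :
    metricInChart h e y v w = metricInChart h e y w v := by
  rw [metricInChart_apply, metricInChart_apply]
  exact h.symm (e.symm y) _ _

lemma isMetricOn_metricInChart [FiniteDimensional ℝ E] [IsManifold 𝓘(ℝ, E) ∞ N]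
    (h : Metric E N) {e : OpenPartialHomeomorph N E} (he : e ∈ atlas E N) :
    IsMetricOn (metricInChart h e) e.target where
  isOpen := e.open_target
  smooth _ hy := (contDiffOn_metricInChart h he).contDiffAt (e.open_target.mem_nhds hy)
  symm y _ v w := metricInChart_symm h e y v w
  pos _ hy _ hv := metricInChart_self_pos h he hy hv

/-! ### The energy density of a harmonic map -/

section Map

variable [IsManifold 𝓘(ℝ, E) ∞ N] {h : Metric E N} {Q : Plane → N}
  {e : OpenPartialHomeomorph N E}

lemma contDiffAt_chart_comp (hQ : ContMDiff 𝓘(ℝ, Plane) 𝓘(ℝ, E) ∞ Q) (he : e ∈ atlas E N)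
    {x : Plane} (hx : Q x ∈ e.source) : ContDiffAt ℝ ∞ (fun x' => e (Q x')) x := by
  rw [← contMDiffAt_iff_contDiffAt]
  exact (contMDiffAt_of_mem_maximalAtlas (IsManifold.subset_maximalAtlas he) hx).comp x
    hQ.contMDiffAt

lemma gradSq_eq_chart (hQ : ContMDiff 𝓘(ℝ, Plane) 𝓘(ℝ, E) ∞ Q) (he : e ∈ atlas E N)
    {x : Plane} (hx : Q x ∈ e.source) :
    gradSq h Q x = ∑ i, metricInChart h e (e (Q x)) (partialD i (fun x' => e (Q x')) x)
      (partialD i (fun x' => e (Q x')) x) := by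
  refine Finset.sum_congr rfl fun i _ => ?_
  have hmd := mdifferentiable_of_mem_atlas he
  have hQx : MDifferentiableAt 𝓘(ℝ, Plane) 𝓘(ℝ, E) Q x := hQ.mdifferentiableAt (by simp)
  have h1 : partialD i (fun x' => e (Q x')) x = mfderiv 𝓘(ℝ, E) 𝓘(ℝ, E) e (Q x)
      (mfderiv 𝓘(ℝ, Plane) 𝓘(ℝ, E) Q x (EuclideanSpace.single i 1 : Plane)) := by
    rw [partialD, ← mfderiv_eq_fderiv]
    exact mfderiv_comp_apply x (hmd.mdifferentiableAt hx) hQx _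
  have h2 : ∀ v : TangentSpace 𝓘(ℝ, E) (Q x), mfderiv 𝓘(ℝ, E) 𝓘(ℝ, E) e.symm (e (Q x))
      (mfderiv 𝓘(ℝ, E) 𝓘(ℝ, E) e (Q x) v) = v := fun v =>
    DFunLike.congr_fun (hmd.symm_comp_deriv hx) v
  rw [metricInChart_apply, h1]
  have h3 := h2 (mfderiv 𝓘(ℝ, Plane) 𝓘(ℝ, E) Q x (EuclideanSpace.single i 1 : Plane))
  rw [h3]
  -- The form `h.inner` depends on its base point through its type, so `e.symm (e (Q x)) = Q x` is
  -- transported on vectors regarded as elements of `E`.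
  have h4 : ∀ p q : N, p = q → ∀ v : E, (h.inner p : E →L[ℝ] E →L[ℝ] ℝ) v v
      = (h.inner q : E →L[ℝ] E →L[ℝ] ℝ) v v := by
    rintro p _ rfl v
    rfl
  exact h4 _ _ (e.left_inv hx).symm _

lemma gradSq_nonneg (x : Plane) : 0 ≤ gradSq h Q x := by
  refine Finset.sum_nonneg fun i _ => ?_
  generalize mfderiv 𝓘(ℝ, Plane) 𝓘(ℝ, E) Q x (EuclideanSpace.single i 1 : Plane) = v
  rcases eq_or_ne v 0 with rfl | hv
  · simp
  · exact (h.pos _ v hv).le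

variable [FiniteDimensional ℝ E]

lemma contDiff_gradSq (hQ : ContMDiff 𝓘(ℝ, Plane) 𝓘(ℝ, E) ∞ Q) : ContDiff ℝ ∞ (gradSq h Q) := by
  rw [contDiff_iff_contDiffAt]
  intro x
  obtain ⟨e, he, hx⟩ : ∃ e ∈ atlas E N, Q x ∈ e.source :=
    ⟨_, chart_mem_atlas E (Q x), mem_chart_source E (Q x)⟩
  have hu := contDiffAt_chart_comp hQ he hx
  have hG : ContDiffAt ℝ ∞ (fun z => metricInChart h e (e (Q z))) x :=
    ContDiffAt.comp (g := metricInChart h e) (f := fun z => e (Q z)) x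
      ((isMetricOn_metricInChart h he).smooth _ (e.map_source hx)) hu
  have heq : gradSq h Q =ᶠ[nhds x] fun z => ∑ i, metricInChart h e (e (Q z))
      (partialD i (fun x' => e (Q x')) z) (partialD i (fun x' => e (Q x')) z) :=
    (hQ.continuous.continuousAt.eventually_mem (e.open_source.mem_nhds hx)).mono fun z hz =>
      gradSq_eq_chart hQ he hz
  refine ContDiffAt.congr_of_eventuallyEq ?_ heq
  exact ContDiffAt.sum fun i _ => (hG.clm_apply (ContDiffAt.partialD hu i)).clm_apply
    (ContDiffAt.partialD hu i)

/-- Every point lies in a chart in which `⟨R(v, w) w, v⟩ ≤ R |v|² |w|²` holds at that point. -/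
def CurvatureBound (h : Metric E N) (R : ℝ) : Prop :=
  ∀ p : N, ∃ e ∈ atlas E N, p ∈ e.source ∧ ∀ v w,
    metricInChart h e (e p) (curvature (metricInChart h e) (e p) v w w) v
      ≤ R * (metricInChart h e (e p) v v * metricInChart h e (e p) w w)

/-- All terms depend only on the germ of the energy density, which near `x` agrees with its
expression in one chart. -/
lemma IsHarmonicMap.bochner (hQ : IsHarmonicMap h Q) {R : ℝ} (hR : 0 ≤ R)
    (hK : CurvatureBound h R) (x : Plane) :
    ∑ j, partialD j (gradSq h Q) x ^ 2
        ≤ 4 * gradSq h Q x * (1 / 2 * laplace (gradSq h Q) x + R / 2 * gradSq h Q x ^ 2) ∧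
      0 ≤ 1 / 2 * laplace (gradSq h Q) x + R / 2 * gradSq h Q x ^ 2 := by
  obtain ⟨e, he, hx, hb⟩ := hK (Q x)
  have key := KahlerHarmonic.bochner (u := fun x' => e (Q x')) (isMetricOn_metricInChart h he)
    (e.open_source.preimage hQ.1.continuous) (fun z hz => contDiffAt_chart_comp hQ.1 he hz)
    (fun z hz => e.map_source hz) (fun z hz => hQ.2 e he z hz) hx hR hb rfl
  set W : Plane → ℝ := fun z => ∑ i, metricInChart h e (e (Q z))
    (partialD i (fun x' => e (Q x')) z) (partialD i (fun x' => e (Q x')) z)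
  have hW : gradSq h Q =ᶠ[nhds x] W :=
    (hQ.1.continuous.continuousAt.eventually_mem (e.open_source.mem_nhds hx)).mono fun z hz =>
      gradSq_eq_chart hQ.1 he hz
  have hW' : ∀ j, partialD j (gradSq h Q) =ᶠ[nhds x] partialD j W := fun j =>
    hW.eventuallyEq_nhds.mono fun z hz => hz.partialD_eq j
  have hl : laplace (gradSq h Q) x = laplace W x :=
    Finset.sum_congr rfl fun j _ => (hW' j).partialD_eq j
  simpa only [hl, hW.eq_of_nhds, fun j => hW.partialD_eq j] using key

/-- Below the threshold the energy density is integrable and satisfies the smallness condition of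
`eq_zero_of_bochner`, so it vanishes, against positive energy. -/
lemma IsHarmonicMap.le_energy (hQ : IsHarmonicMap h Q) (hpos : 0 < energy h Q) {R : ℝ}
    (hR : 0 < R) (hK : CurvatureBound h R) :
    (1 / 2 : ℝ≥0∞) * (1 / ((gagliardoNirenberg : ℝ≥0∞) ^ 4 * ENNReal.ofReal R)) ≤ energy h Q := by
  by_contra! hlt
  have hw := contDiff_gradSq (h := h) hQ.1
  have hlt' := lt_of_mul_lt_mul_left' hlt
  have hfin : ∫⁻ x, ENNReal.ofReal (gradSq h Q x) ≠ ⊤ := hlt'.ne_top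
  have hint : Integrable (gradSq h Q) :=
    (lintegral_ofReal_ne_top_iff_integrable hw.continuous.aestronglyMeasurable
      (Filter.Eventually.of_forall gradSq_nonneg)).1 hfin
  have hzero := eq_zero_of_bochner hR hw gradSq_nonneg (fun x => (hQ.bochner hR.le hK x).1)
    (fun x => (hQ.bochner hR.le hK x).2) hint ?_
  · simp [energy, hzero] at hpos
  · have h1 := ENNReal.mul_lt_of_lt_div hlt'
    rw [← ofReal_integral_eq_lintegral_ofReal hint (Filter.Eventually.of_forall gradSq_nonneg),
      ← ENNReal.ofReal_coe_nnreal, ← ENNReal.ofReal_pow (by positivity),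
      ← ENNReal.ofReal_mul (by positivity),
      ← ENNReal.ofReal_mul (integral_nonneg gradSq_nonneg), ENNReal.ofReal_lt_one] at h1
    linarith

end Map

/-! ### Upper curvature bounds, given or from compactness -/

section CurvatureBounds

variable [FiniteDimensional ℝ E]

lemma IsMetricOn.curvature_smul_self {G : E → E →L[ℝ] E →L[ℝ] ℝ} {U : Set E}
    (hG : IsMetricOn G U) {y : E} (hy : y ∈ U) (a : ℝ) (v z : E) :
    curvature G y v (a • v) z = 0 := by
  rw [curvature_eq_of_differentiableAt
    ((hG.contDiffAt_christoffelCLM hy).differentiableAt (by simp))]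
  simp only [map_smul, smul_apply]
  abel

/-- For independent vectors, `R ≥ 0` allows the Gram determinant to be replaced by the larger
`|v|²|w|²`; for dependent ones the curvature term is zero. -/
lemma IsMetricOn.curvature_le_of_sectional_le {G : E → E →L[ℝ] E →L[ℝ] ℝ} {U : Set E}
    (hG : IsMetricOn G U) {y : E} (hy : y ∈ U) {R : ℝ} (hR : 0 ≤ R)
    (hK : ∀ v w, LinearIndependent ℝ ![v, w] → sectional G y v w ≤ R) (v w : E) :
    G y (curvature G y v w w) v ≤ R * (G y v v * G y w w) := by
  have hvw := mul_nonneg (hG.nonneg hy v) (hG.nonneg hy w)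
  rcases eq_or_ne v 0 with rfl | hv
  · simp
  by_cases hli : LinearIndependent ℝ ![v, w]
  · have hw : w ≠ 0 := by simpa using hli.ne_zero 1
    have hww := hG.pos y hy w hw
    -- The squared length of this vector is `G y w w` times the Gram determinant, which is therefore
    -- positive.
    have hz : G y w w • v - G y v w • w ≠ 0 := by
      intro h0
      rw [sub_eq_add_neg, ← neg_smul] at h0
      exact hww.ne' ((LinearIndependent.pair_iff.1 hli _ _ h0).1)
    have hzz := hG.pos y hy _ hz
    simp only [map_sub, map_smul, sub_apply, smul_apply, smul_eq_mul, hG.symm y hy w v] at hzz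
    have hden : 0 < G y v v * G y w w - G y v w ^ 2 := by
      refine (mul_pos_iff_of_pos_left hww).1 ?_
      linarith
    have := hK v w hli
    rw [sectional, div_le_iff₀ hden] at this
    nlinarith [mul_nonneg hR (sq_nonneg (G y v w))]
  · rw [LinearIndependent.pair_iff' hv] at hli
    push Not at hli
    obtain ⟨a, rfl⟩ := hli
    rw [hG.curvature_smul_self hy]
    simpa using mul_nonneg hR hvw

lemma IsMetricOn.exists_curvature_le {G : E → E →L[ℝ] E →L[ℝ] ℝ} {U : Set E}
    (hG : IsMetricOn G U) {y₀ : E} (hy₀ : y₀ ∈ U) :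
    ∃ R > 0, ∀ᶠ y in nhds y₀, ∀ v w,
      G y (curvature G y v w w) v ≤ R * (G y v v * G y w w) := by
  obtain ⟨r, hr, hrU⟩ := Metric.nhds_basis_closedBall.mem_iff.1 (hG.isOpen.mem_nhds hy₀)
  have : ProperSpace E := FiniteDimensional.proper_real E
  set S : Set (E × E × E) :=
    Metric.closedBall y₀ r ×ˢ (Metric.sphere (0 : E) 1 ×ˢ Metric.sphere (0 : E) 1)
  have hS : IsCompact S :=
    (isCompact_closedBall y₀ r).prod ((isCompact_sphere 0 1).prod (isCompact_sphere 0 1))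
  have hne : ∀ v ∈ Metric.sphere (0 : E) 1, v ≠ 0 := by
    rintro v hv rfl
    simp at hv
  -- This quotient is homogeneous of degree `0` in each vector, so its maximum over unit vectors of
  -- the norm of `E` controls all nonzero vectors.
  set F : E × E × E → ℝ := fun q => G q.1 (curvature G q.1 q.2.1 q.2.2 q.2.2) q.2.1
    / (G q.1 q.2.1 q.2.1 * G q.1 q.2.2 q.2.2) with hF
  have hcont : ContinuousOn F S := by
    rintro ⟨y, v, w⟩ ⟨hy, hv, hw⟩
    have hyU : y ∈ U := hrU hy
    have hd : ∀ z ∈ U, DifferentiableAt ℝ (christoffelCLM G) z := fun z hz =>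
      (hG.contDiffAt_christoffelCLM hz).differentiableAt (by simp)
    have hfst : ContinuousAt (fun q : E × E × E => q.1) (y, v, w) := continuousAt_fst
    have c1 : ContinuousAt (fun q : E × E × E => q.2.1) (y, v, w) := by fun_prop
    have c2 : ContinuousAt (fun q : E × E × E => q.2.2) (y, v, w) := by fun_prop
    have cG : ContinuousAt (fun q : E × E × E => G q.1) (y, v, w) :=
      ContinuousAt.comp (f := fun q : E × E × E => q.1) (x := (y, v, w))
        (hG.smooth y hyU).continuousAt hfst
    have cΓ : ContinuousAt (fun q : E × E × E => christoffelCLM G q.1) (y, v, w) :=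
      ContinuousAt.comp (f := fun q : E × E × E => q.1) (x := (y, v, w))
        (hG.contDiffAt_christoffelCLM hyU).continuousAt hfst
    have cD : ContinuousAt (fun q : E × E × E => fderiv ℝ (christoffelCLM G) q.1) (y, v, w) :=
      ContinuousAt.comp (f := fun q : E × E × E => q.1) (x := (y, v, w))
        ((hG.contDiffAt_christoffelCLM hyU).fderiv_right (m := ∞) (by simp)).continuousAt hfst
    have cR : ContinuousAt (fun q : E × E × E => curvature G q.1 q.2.1 q.2.2 q.2.2)
        (y, v, w) := by
      have heq : (fun q : E × E × E => curvature G q.1 q.2.1 q.2.2 q.2.2) =ᶠ[nhds (y, v, w)]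
          fun q => fderiv ℝ (christoffelCLM G) q.1 q.2.1 q.2.2 q.2.2
            - fderiv ℝ (christoffelCLM G) q.1 q.2.2 q.2.1 q.2.2
            + christoffelCLM G q.1 q.2.1 (christoffelCLM G q.1 q.2.2 q.2.2)
            - christoffelCLM G q.1 q.2.2 (christoffelCLM G q.1 q.2.1 q.2.2) := by
        filter_upwards [hfst.eventually_mem (hG.isOpen.mem_nhds hyU)] with q hq
        exact curvature_eq_of_differentiableAt (hd _ hq) _ _ _
      refine ContinuousAt.congr ?_ heq.symm
      exact (((((cD.clm_apply c1).clm_apply c2).clm_apply c2).sub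
        (((cD.clm_apply c2).clm_apply c1).clm_apply c2)).add
        ((cΓ.clm_apply c1).clm_apply ((cΓ.clm_apply c2).clm_apply c2))).sub
        ((cΓ.clm_apply c2).clm_apply ((cΓ.clm_apply c1).clm_apply c2))
    refine ContinuousAt.continuousWithinAt (ContinuousAt.div ((cG.clm_apply cR).clm_apply c1)
      (((cG.clm_apply c1).clm_apply c1).mul ((cG.clm_apply c2).clm_apply c2)) ?_)
    exact (mul_pos (hG.pos y hyU v (hne v hv)) (hG.pos y hyU w (hne w hw))).ne'
  obtain ⟨M, hM⟩ := hS.bddAbove_image hcont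
  refine ⟨max M 1, lt_max_of_lt_right one_pos, ?_⟩
  filter_upwards [Metric.closedBall_mem_nhds y₀ hr] with y hy v w
  have hyU : y ∈ U := hrU hy
  rcases eq_or_ne v 0 with rfl | hv
  · simp
  rcases eq_or_ne w 0 with rfl | hw
  · have := hG.curvature_smul_self hyU 0 v 0
    rw [zero_smul] at this
    simp [this]
  have hunit : ∀ z : E, z ≠ 0 → ‖z‖⁻¹ • z ∈ Metric.sphere (0 : E) 1 := by
    intro z hz
    simp [norm_smul, hz]
  have hFle : F (y, ‖v‖⁻¹ • v, ‖w‖⁻¹ • w) ≤ max M 1 :=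
    (hM ⟨_, ⟨hy, hunit v hv, hunit w hw⟩, rfl⟩).trans (le_max_left _ _)
  have hpos : 0 < G y v v * G y w w := mul_pos (hG.pos y hyU v hv) (hG.pos y hyU w hw)
  have hscale : F (y, ‖v‖⁻¹ • v, ‖w‖⁻¹ • w) =
      G y (curvature G y v w w) v / (G y v v * G y w w) := by
    have hvn : ‖v‖ ≠ 0 := norm_ne_zero_iff.2 hv
    have hwn : ‖w‖ ≠ 0 := norm_ne_zero_iff.2 hw
    have hcurv : curvature G y (‖v‖⁻¹ • v) (‖w‖⁻¹ • w) (‖w‖⁻¹ • w) =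
        (‖v‖⁻¹ * ‖w‖⁻¹ ^ 2) • curvature G y v w w := by
      have hd : DifferentiableAt ℝ (christoffelCLM G) y :=
        (hG.contDiffAt_christoffelCLM hyU).differentiableAt (by simp)
      simp only [curvature_eq_of_differentiableAt hd, map_smul, smul_apply]
      module
    simp only [hF, hcurv, map_smul, smul_apply, smul_eq_mul]
    have hv0 := (hG.pos y hyU v hv).ne'
    have hw0 := (hG.pos y hyU w hw).ne'
    field_simp
  rw [hscale, div_le_iff₀ hpos] at hFle
  exact hFle

variable [IsManifold 𝓘(ℝ, E) ∞ N] (h : Metric E N)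

lemma curvatureBound_of_sectional_le {R : ℝ} (hR : 0 ≤ R)
    (hK : ∀ k ∈ sectionalCurvatures h, k ≤ R) : CurvatureBound h R := by
  intro p
  have he := chart_mem_atlas E p
  have hp := mem_chart_source E p
  refine ⟨chartAt E p, he, hp, fun v w => ?_⟩
  refine (isMetricOn_metricInChart h he).curvature_le_of_sectional_le
    ((chartAt E p).map_source hp) hR (fun v w hli => hK _ ?_) v w
  exact ⟨_, he, _, (chartAt E p).map_source hp, v, w, hli, rfl⟩

/-- The local bounds near each point are patched by compactness; on a union the maximum of the two
constants works, each point keeping its own chart. -/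
lemma exists_curvatureBound [CompactSpace N] : ∃ R > 0, CurvatureBound h R := by
  have key : ∃ R > 0, ∀ p ∈ (Set.univ : Set N), ∃ e ∈ atlas E N, p ∈ e.source ∧ ∀ v w,
      metricInChart h e (e p) (curvature (metricInChart h e) (e p) v w w) v
        ≤ R * (metricInChart h e (e p) v v * metricInChart h e (e p) w w) := by
    refine isCompact_univ.induction_on ⟨1, one_pos, by simp⟩ ?_ ?_ ?_
    · rintro s t hst ⟨R, hR, hRt⟩
      exact ⟨R, hR, fun p hp => hRt p (hst hp)⟩
    · have hmono : ∀ {R R' : ℝ} {e : OpenPartialHomeomorph N E} {p : N}, e ∈ atlas E N →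
          p ∈ e.source → R ≤ R' → ∀ v w,
          R * (metricInChart h e (e p) v v * metricInChart h e (e p) w w)
            ≤ R' * (metricInChart h e (e p) v v * metricInChart h e (e p) w w) := by
        intro R R' e p he hp hRR v w
        have hG := isMetricOn_metricInChart h he
        exact mul_le_mul_of_nonneg_right hRR
          (mul_nonneg (hG.nonneg (e.map_source hp) v) (hG.nonneg (e.map_source hp) w))
      rintro s t ⟨R, hR, hs⟩ ⟨R', hR', ht⟩
      refine ⟨max R R', lt_max_of_lt_left hR, ?_⟩
      rintro p (hp | hp)
      · obtain ⟨e, he, hpe, hb⟩ := hs p hp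
        exact ⟨e, he, hpe, fun v w => (hb v w).trans (hmono he hpe (le_max_left _ _) v w)⟩
      · obtain ⟨e, he, hpe, hb⟩ := ht p hp
        exact ⟨e, he, hpe, fun v w => (hb v w).trans (hmono he hpe (le_max_right _ _) v w)⟩
    · intro p _
      have he := chart_mem_atlas E p
      have hp := mem_chart_source E p
      obtain ⟨R, hR, hb⟩ := (isMetricOn_metricInChart h he).exists_curvature_le
        ((chartAt E p).map_source hp)
      refine ⟨{q | q ∈ (chartAt E p).source ∧ _}, mem_nhdsWithin_of_mem_nhds
        (((chartAt E p).open_source.mem_nhds hp |> Filter.Eventually.and <|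
          ((chartAt E p).continuousAt hp).eventually hb)), R, hR, ?_⟩
      rintro q ⟨hq, hqb⟩
      exact ⟨_, he, hq, hqb⟩
  obtain ⟨R, hR, hb⟩ := key
  exact ⟨R, hR, fun p => hb p (Set.mem_univ p)⟩

variable {h} in
lemma CurvatureBound.le_criticalEnergy {R : ℝ} (hR : 0 < R) (hK : CurvatureBound h R) :
    (1 / 2 : ℝ≥0∞) * (1 / ((gagliardoNirenberg : ℝ≥0∞) ^ 4 * ENNReal.ofReal R))
      ≤ criticalEnergy h := by
  refine le_sInf ?_
  rintro _ ⟨Q, hQ, hpos, rfl⟩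
  exact hQ.le_energy hpos hR hK

end CurvatureBounds

end Charts

end KahlerHarmonic

end

/-! ### The lower bound for the critical energy -/

theorem lemma2
    {E : Type*} [NormedAddCommGroup E] [NormedSpace ℝ E] [FiniteDimensional ℝ E]
    {N : Type*} [TopologicalSpace N] [ChartedSpace E N] [IsManifold 𝓘(ℝ, E) ∞ N]
    [T2Space N] [CompactSpace N]
    (h : KahlerHarmonic.Metric E N)
    (J : ∀ p : N, TangentSpace 𝓘(ℝ, E) p →L[ℝ] TangentSpace 𝓘(ℝ, E) p)
    (hJ : KahlerHarmonic.IsKahler h J) :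
    0 < KahlerHarmonic.criticalEnergy h ∧
      ∀ R : ℝ, (∀ k ∈ KahlerHarmonic.sectionalCurvatures h, k ≤ R) →
        (1 / 2 : ℝ≥0∞) *
            (1 / ((KahlerHarmonic.gagliardoNirenberg : ℝ≥0∞) ^ 4 * ENNReal.ofReal R))
          ≤ KahlerHarmonic.criticalEnergy h := by
  constructor
  · obtain ⟨R, hR, hK⟩ := KahlerHarmonic.exists_curvatureBound h
    refine lt_of_lt_of_le ?_ (hK.le_criticalEnergy hR)
    refine ENNReal.mul_pos (by simp) (ENNReal.div_pos one_ne_zero ?_).ne'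
    exact ENNReal.mul_ne_top (ENNReal.pow_ne_top ENNReal.coe_ne_top) ENNReal.ofReal_ne_top
  · intro R hK
    -- The bound is proved for positive constants only; `max R 0 + ε` is one for every real `R`. As
    -- `ε → 0` the limit is the claimed value, which is `∞` for `R ≤ 0` since then `ENNReal.ofReal R
    -- = 0` and `1 / 0 = ∞`.
    have key : ∀ ε : ℝ, 0 < ε → (1 / 2 : ℝ≥0∞) * (1 /
        ((KahlerHarmonic.gagliardoNirenberg : ℝ≥0∞) ^ 4 * ENNReal.ofReal (max R 0 + ε)))
          ≤ KahlerHarmonic.criticalEnergy h := by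
      intro ε hε
      have hpos : 0 < max R 0 + ε := add_pos_of_nonneg_of_pos (le_max_right _ _) hε
      refine (KahlerHarmonic.curvatureBound_of_sectional_le h hpos.le
        fun k hk => ?_).le_criticalEnergy hpos
      linarith [hK k hk, le_max_left R 0]
    have hlim : Filter.Tendsto (fun ε : ℝ => (1 / 2 : ℝ≥0∞) * (1 /
        ((KahlerHarmonic.gagliardoNirenberg : ℝ≥0∞) ^ 4 * ENNReal.ofReal (max R 0 + ε))))
        (nhdsWithin 0 (Set.Ioi 0)) (nhds ((1 / 2 : ℝ≥0∞) * (1 /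
        ((KahlerHarmonic.gagliardoNirenberg : ℝ≥0∞) ^ 4 * ENNReal.ofReal R)))) := by
      refine tendsto_nhdsWithin_of_tendsto_nhds ?_
      simp only [one_div]
      refine ENNReal.Tendsto.const_mul (tendsto_inv_iff.2 ?_) (Or.inr (by simp))
      refine ENNReal.Tendsto.const_mul ?_
        (Or.inr (ENNReal.pow_ne_top ENNReal.coe_ne_top))
      have : ENNReal.ofReal R = ENNReal.ofReal (max R 0 + 0) := by
        rw [add_zero, ENNReal.ofReal_max]
        simp
      rw [this]
      exact ENNReal.tendsto_ofReal (tendsto_const_nhds.add Filter.tendsto_id)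
    exact le_of_tendsto hlim (by filter_upwards [self_mem_nhdsWithin] using key)
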